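/- Let $a,b>0$ and let $m(z)=i\frac{1-z}{1+z}$, which maps $\mathbb D$ onto the upper half plane $\mathbb C_+$ and $\mathbb T\setminus\{-1\}$ onto $\mathbb R$. Put $\Theta(w)=\mathrm{diag}(e^{iaw},e^{ibw})$ and $$K_{\Theta\circ m}=(\Theta\circ m)\,\overline{(H^2_0)^2}\cap (H^2)^2\subseteq L^2(\mathbb T)^2 ,$$ where $H^2_0=\{f\in H^2: f(0)=0\}$, and let $P_{\Theta\circ m}$ be the orthogonal projection of $L^2(\mathbb T)^2$ onto $K_{\Theta\circ m}$. For a $2\times2$ matrix function $\Phi$ with entries in $L^2(\mathbb T)$, the map $f\mapsto P_{\Theta\circ m}(\Phi f)$ is defined on the dense subspace $K_{\Theta\circ m}\cap (H^\infty)^2$ of $K_{\Theta\circ m}$; if it is bounded, its extension to a bounded operator on $K_{\Theta\circ m}$ is the matrix-valued truncated Toeplitz operator (MTTO) $A^{\Theta\circ m}_{\Phi}$. For a $2\times 2$ matrix $G=(g_{ij})$ of functions on $\mathbb R$ that are locally integrable and define tempered distributions (for instance, $g_{ij}\in L^1(\mathbb R)$), the matricial truncated Wiener–Hopf operator $W_G$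 is the operator on the Hilbert space $L^2(0,a)\oplus L^2(0,b)$ that is densely defined, for bounded $k_1,k_2$, by $$ (W_Gk)_i(x)=\int_0^a g_{i1}(x-t)k_1(t)\,dt+\int_0^b g_{i2}(x-t)k_2(t)\,dt ,$$ where $x\in(0,a)$ for $i=1$ and $x\in(0,b)$ for $i=2$. It is called bounded if it extends to a bounded operator, again denoted by $W_G$. Let $\mathcal F$ be the unitary Fourier transform $\mathcal Fg(t)=(2\pi)^{-1/2}\int_{\mathbb R} g(x)e^{-ixt}\,dx$ on $L^2(\mathbb R)$, and let $V$ be the unitary map $Vf(x)=\frac{1}{\sqrt\pi\,(x+i)}f(m^{-1}(x))$ from $L^2(\mathbb T)$ (normalised arc length) to $L^2(\mathbb R)$, which maps $H^2(\mathbb D)$ onto $H^2(\mathbb C_+)$. Both act on columns entry by entry. Suppose that $G=\hat H$ for a $2\times2$ matrix function $H$ on $\mathbb R$, where $\hat H(t)=\frac1{2\pi}\int_{\mathbb R} H(x)e^{-ixt}\,dx$ entry by entry, in the sense of tempered distributions, and suppose that $$H\,\mathcal F^{-1}\bigl(L^\infty(0,a)\oplus L^\infty(0,b)\bigr)\subseteq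 L^2(\mathbb R)^2 .$$ Then $W_G$ is bounded if and only if the MTTO $A^{\Theta\circ m}_{H\circ m}$ is bounded (that is, if and only if $H\circ m$ has entries in $L^2(\mathbb T)$ and the map $f\mapsto P_{\Theta\circ m}((H\circ m)f)$ on $K_{\Theta\circ m}\cap(H^\infty)^2$ is bounded). Moreover $\mathcal F\circ V$ restricts to a unitary map $U$ of $K_{\Theta\circ m}$ onto $L^2(0,a)\oplus L^2(0,b)$, and if the two operators are bounded, then $W_G\,U=U\,A^{\Theta\circ m}_{H\circ m}$, so that they are unitarily equivalent via $\mathcal F\circ V$. -/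

import Mathlib

open MeasureTheory
open scoped FourierTransform SchwartzMap ComplexConjugate

namespace WienerHopf

noncomputable section

/-- The positivity of the period that is needed to do Fourier analysis on `ℝ / 2πℤ`. -/
instance factTwoPiPos : Fact (0 < 2 * Real.pi) := ⟨Real.two_pi_pos⟩

/-! ### The unit circle -/

/-- The unit circle, parametrised by the angle: `φ` stands for the point `z = exp (i φ)`. It
carries the normalised arc length measure `AddCircle.haarAddCircle`. -/
abbrev T : Type := AddCircle (2 * Real.pi)

/-- `L²` of the unit circle (normalised arc length). -/
abbrev L2T : Type := Lp ℂ 2 (AddCircle.haarAddCircle : Measure T)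

/-- The Hilbert space `(L²)²` of columns of two functions in `L²` of the circle. -/
abbrev L2T2 : Type := PiLp 2 (fun _ : Fin 2 => L2T)

/-- The Hardy space `H²` of the disc, as the space of those functions in `L²` of the circle whose
negative Fourier coefficients vanish. -/
def hardy : Submodule ℂ L2T where
  carrier := {f | ∀ n : ℤ, n < 0 → fourierCoeff (f : T → ℂ) n = 0}
  zero_mem' := by
    intro n _
    rw [← fourierBasis_repr]
    simp
  add_mem' := by
    intro f g hf hg n hn
    have hf' := hf n hn
    have hg' := hg n hn
    rw [← fourierBasis_repr] at hf' hg' ⊢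
    simp [hf', hg']
  smul_mem' := by
    intro c f hf n hn
    have hf' := hf n hn
    rw [← fourierBasis_repr] at hf' ⊢
    simp [hf']

/-- The functions in `H²` that vanish at the origin of the disc: the value at `0` is the zeroth
Fourier coefficient. -/
def hardyZero : Submodule ℂ L2T where
  carrier := {f | f ∈ hardy ∧ fourierCoeff (f : T → ℂ) 0 = 0}
  zero_mem' := by
    refine ⟨hardy.zero_mem, ?_⟩
    rw [← fourierBasis_repr]
    simp
  add_mem' := by
    intro f g hf hg
    refine ⟨hardy.add_mem hf.1 hg.1, ?_⟩
    have hf' := hf.2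
    have hg' := hg.2
    rw [← fourierBasis_repr] at hf' hg' ⊢
    simp [hf', hg']
  smul_mem' := by
    intro c f hf
    refine ⟨hardy.smul_mem c hf.1, ?_⟩
    have hf' := hf.2
    rw [← fourierBasis_repr] at hf' ⊢
    simp [hf']

/-- The model space `K_Θ = Θ · conj (H²₀)² ∩ (H²)²`, a subspace of `(L²)²`. -/
def modelSpace (Θ : T → Matrix (Fin 2) (Fin 2) ℂ) : Submodule ℂ L2T2 where
  carrier := {f | (∀ i, f i ∈ hardy) ∧ ∃ g : L2T2, (∀ i, g i ∈ hardyZero) ∧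
    ∀ i, (f i : T → ℂ) =ᵐ[AddCircle.haarAddCircle] fun z => ∑ j, Θ z i j * conj (g j z)}
  zero_mem' := by
    refine ⟨fun i => hardy.zero_mem, 0, fun i => hardyZero.zero_mem, fun i => ?_⟩
    filter_upwards [Lp.coeFn_zero ℂ 2 (AddCircle.haarAddCircle : Measure T)] with z hz
    simp
  add_mem' := by
    rintro f f' ⟨hf, g, hg, hfg⟩ ⟨hf', g', hg', hfg'⟩
    refine ⟨fun i => hardy.add_mem (hf i) (hf' i), g + g',
      fun i => hardyZero.add_mem (hg i) (hg' i), fun i => ?_⟩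
    filter_upwards [hfg i, hfg' i, Lp.coeFn_add (f i) (f' i), Lp.coeFn_add (g 0) (g' 0),
      Lp.coeFn_add (g 1) (g' 1)] with z h1 h2 h3 h4 h5
    simp only [PiLp.add_apply, h3, Pi.add_apply, h1, h2, Fin.sum_univ_two, h4, h5, map_add]
    ring
  smul_mem' := by
    rintro c f ⟨hf, g, hg, hfg⟩
    refine ⟨fun i => hardy.smul_mem c (hf i), conj c • g,
      fun i => hardyZero.smul_mem _ (hg i), fun i => ?_⟩
    filter_upwards [hfg i, Lp.coeFn_smul c (f i), Lp.coeFn_smul (conj c) (g 0),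
      Lp.coeFn_smul (conj c) (g 1)] with z h1 h3 h4 h5
    simp only [PiLp.smul_apply, h3, Pi.smul_apply, h1, Fin.sum_univ_two, h4, h5, smul_eq_mul,
      map_mul, Complex.conj_conj]
    ring

/-- The bounded operator `A` on `K_Θ` is the matrix-valued truncated Toeplitz operator with symbol
`Φ`: the entries of `Φ` are in `L²`, and `A f = P_Θ (Φ f)` for every `f` in `K_Θ ∩ (H^∞)²`, where
`P_Θ` is the orthogonal projection of `(L²)²` onto `K_Θ`. That `A f` is `P_Θ u` is expressed by
`A f ∈ K_Θ` (the type of `A`) and `u - A f ⟂ K_Θ`. -/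
def IsMTTO (Θ Φ : T → Matrix (Fin 2) (Fin 2) ℂ) (A : modelSpace Θ →L[ℂ] modelSpace Θ) : Prop :=
  (∀ i j, MemLp (fun z => Φ z i j) 2 (AddCircle.haarAddCircle : Measure T)) ∧
  ∀ f : modelSpace Θ,
    (∀ i, MemLp ((f : L2T2) i : T → ℂ) ⊤ (AddCircle.haarAddCircle : Measure T)) →
    ∃ u : L2T2,
      (∀ i, (u i : T → ℂ) =ᵐ[AddCircle.haarAddCircle]
        fun z => ∑ j, Φ z i j * ((f : L2T2) j : T → ℂ) z) ∧
      u - (A f : L2T2) ∈ (modelSpace Θ)ᗮ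

/-! ### From the disc to the half plane -/

/-- `m(z) = i (1 - z) / (1 + z)`, which maps the disc onto the upper half plane. -/
def cayley (z : ℂ) : ℂ := Complex.I * (1 - z) / (1 + z)

/-- `m` on the unit circle, with values in the real line: there `m(z)` is real, and
`m(exp (i φ)) = tan (φ / 2)`. -/
def cayleyBdry (z : T) : ℝ := (cayley (AddCircle.toCircle z : ℂ)).re

/-- The inverse of `m` from the real line to the circle: `x` is mapped to the point with the
angle `2 arctan x`, that is, to `(i - x) / (i + x)`. -/
def cayleyBdryInv (x : ℝ) : T := ((2 * Real.arctan x : ℝ) : T)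

/-- The unitary map `V` from the disc to the half plane, on boundary functions:
`(V f)(x) = f (m⁻¹ x) / (√π (x + i))`. -/
def halfPlane (f : T → ℂ) (x : ℝ) : ℂ :=
  ((Real.sqrt Real.pi : ℂ) * ((x : ℂ) + Complex.I))⁻¹ * f (cayleyBdryInv x)

/-- The matrix function `Θ(w) = diag (exp (i a w), exp (i b w))`. -/
def diagInner (a b : ℝ) (w : ℂ) : Matrix (Fin 2) (Fin 2) ℂ :=
  Matrix.diagonal ![Complex.exp (Complex.I * a * w), Complex.exp (Complex.I * b * w)]

/-- `Θ ∘ m` on the unit circle, where `Θ(w) = diag (exp (i a w), exp (i b w))`. -/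
def diagInnerDisc (a b : ℝ) (z : T) : Matrix (Fin 2) (Fin 2) ℂ :=
  diagInner a b (cayley (AddCircle.toCircle z : ℂ))

/-! ### Fourier transforms -/

/-- The unitary Fourier transform on `L²(ℝ)`,
`(𝓕 g)(t) = (2π)^(-1/2) ∫ g(x) exp (-i x t) dx` (extended from the integrable functions), obtained
by rescaling from Mathlib's one, whose kernel is `exp (-2π i x t)`. -/
def unitaryFourier (g : Lp ℂ 2 (volume : Measure ℝ)) (t : ℝ) : ℂ :=
  ((Real.sqrt (2 * Real.pi) : ℝ) : ℂ)⁻¹ *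
    ((𝓕 g : Lp ℂ 2 (volume : Measure ℝ)) : ℝ → ℂ) (t / (2 * Real.pi))

/-- The inverse of the unitary Fourier transform of a bounded function `k` on `(0, c)`:
`ǩ(x) = (2π)^(-1/2) ∫_0^c k(t) exp (i x t) dt`. -/
def invFourierInterval (c : ℝ) (k : ℝ → ℂ) (x : ℝ) : ℂ :=
  ((Real.sqrt (2 * Real.pi) : ℝ) : ℂ)⁻¹ *
    ∫ t in Set.Ioo 0 c, Complex.exp (Complex.I * x * t) * k t

/-- `g = ĥ` where `ĥ(t) = (2π)⁻¹ ∫ h(x) exp (-i x t) dx`, in the sense of tempered distributions: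
`∫ g φ = ∫ h φ̂` for all Schwartz functions `φ`, where
`φ̂(x) = (2π)⁻¹ ∫ φ(t) exp (-i x t) dt`. This is the normalisation with
`(h ǩ)^ = ĥ * k` as required for symbols. -/
def IsSymbolTransform (h g : ℝ → ℂ) : Prop :=
  ∀ φ : 𝓢(ℝ, ℂ),
    Integrable (fun t => g t * φ t) ∧
    Integrable (fun x => h x * (((2 * Real.pi : ℝ) : ℂ)⁻¹ *
      𝓕 (φ : ℝ → ℂ) (x / (2 * Real.pi)))) ∧
    ∫ t, g t * φ t =
      ∫ x, h x * (((2 * Real.pi : ℝ) : ℂ)⁻¹ * 𝓕 (φ : ℝ → ℂ) (x / (2 * Real.pi)))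

/-! ### The truncated Wiener-Hopf operator -/

/-- Lebesgue measure on the interval `(0, c)`. -/
abbrev volIoo (c : ℝ) : Measure ℝ := volume.restrict (Set.Ioo 0 c)

/-- The Hilbert space `L²(0, a) ⊕ L²(0, b)`; the components are indexed by `Fin 2` and the lengths
of the intervals are `![a, b]`. -/
abbrev L2Intervals (a b : ℝ) : Type :=
  PiLp 2 (fun i : Fin 2 => Lp ℂ 2 (volIoo ((![a, b] : Fin 2 → ℝ) i)))

/-- The components `∫_0^a G_{i1}(x - t) k_1(t) dt + ∫_0^b G_{i2}(x - t) k_2(t) dt` of the column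
`W_G k` at `x`. -/
def wienerHopfFun (a b : ℝ) (G : ℝ → Matrix (Fin 2) (Fin 2) ℂ) (k : Fin 2 → ℝ → ℂ) (i : Fin 2)
    (x : ℝ) : ℂ :=
  ∑ j, ∫ t in Set.Ioo 0 ((![a, b] : Fin 2 → ℝ) j), G (x - t) i j * k j t

/-- The bounded operator `W` on `L²(0, a) ⊕ L²(0, b)` extends the matricial truncated Wiener-Hopf
operator `W_G`, which is given by the integral on the dense subspace of the bounded functions. -/
def IsWienerHopf (a b : ℝ) (G : ℝ → Matrix (Fin 2) (Fin 2) ℂ)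
    (W : L2Intervals a b →L[ℂ] L2Intervals a b) : Prop :=
  ∀ k : L2Intervals a b,
    (∀ j, MemLp (k j : ℝ → ℂ) ⊤ (volIoo ((![a, b] : Fin 2 → ℝ) j))) →
    ∀ i, (W k i : ℝ → ℂ) =ᵐ[volIoo ((![a, b] : Fin 2 → ℝ) i)]
      wienerHopfFun a b G (fun j => (k j : ℝ → ℂ)) i

end

end WienerHopf

/-! Both operators are recognised by one bilinear form. For smooth `l`, `k` compactly supported in
the intervals, with inverse Fourier transforms `ľ`, `ǩ`, the form of the `(i, j)` entry is `∫ conj ľ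
· H i j · ǩ` (`HasSymbolForm`). A bounded operator with this form is unique, because test functions
separate the points of `L²` of an interval.

The Wiener-Hopf operator has this form by Fubini and the definition of the distributional transform
(`IsSymbolTransform.integral_mul_conv`). For the Toeplitz operator, `V` turns multiplication by `H ∘
m` into multiplication by `H`, and the projection disappears when paired with elements of the model
space (`IsMTTO.hasSymbolForm`). The inverse transforms of test functions decay fast, so they come
from bounded functions on the circle and lie in the domain of the Toeplitz operator.

Conversely, a bounded operator with the form is of both kinds. Its adjoint is computed explicitly on
test functions, and duality then gives its values on the whole required domain
(`HasSymbolForm.isWienerHopf`, `HasSymbolForm.isMTTO`). The Toeplitz side needs `H / (x + i)` in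
`L²`, that is, `H ∘ m` in `L²` of the circle. The hypothesis on `H` gives this when applied to two
exponentials (`memLp_inv_add_I_mul_of_interval`).

The image of the model space is found by a Paley-Wiener argument. Under `V`, the functions `exp (i c
m) z ^ n` become `exp (i c x)` times explicit rational functions. Their Fourier transforms live in
`(c, ∞)` for `n ≥ 0` and in `(-∞, c)` for `n < 0`. Since the family is total, vanishing of half of
the coefficients means support in a half line. Using `c = 0` together with `c = a` or `c = b` yields
the intervals (`mem_modelSpace_diagInnerDisc_iff`). -/

namespace WienerHopf

open scoped ContDiff

noncomputable section

/-! ### Weighted composition operators as isometries of `L²` -/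

section WeightedComposition

variable {α β : Type*} [MeasurableSpace α] [MeasurableSpace β] {μ : Measure α} {ν : Measure β}
  {w : β → ℂ} {φ : β → α}

/-- The compatibility of a weight `w` and a map `φ` with two measures that makes
`f ↦ w * (f ∘ φ)` an isometry on `L²`. -/
structure IsometricWeight (μ : Measure α) (ν : Measure β) (w : β → ℂ) (φ : β → α) : Prop where
  measurable_weight : Measurable w
  measurable_map : Measurable φ
  map_eq : (ν.withDensity (fun x => ‖w x‖ₑ ^ 2)).map φ = μ

namespace IsometricWeight

/-- Where `w` vanishes the density has no mass, so nothing is known there. The weight may have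
zeros: extension by zero uses an indicator. -/
theorem ae_comp (h : IsometricWeight μ ν w φ) {p : α → Prop} (hp : ∀ᵐ z ∂μ, p z) :
    ∀ᵐ x ∂ν, w x ≠ 0 → p (φ x) := by
  rw [← h.map_eq] at hp
  have h1 := ae_of_ae_map h.measurable_map.aemeasurable hp
  rw [ae_withDensity_iff (h.measurable_weight.enorm.pow_const 2)] at h1
  filter_upwards [h1] with x hx hw
  exact hx (by simpa using hw)

theorem congr (h : IsometricWeight μ ν w φ) {f g : α → ℂ} (hfg : f =ᵐ[μ] g) :
    (fun x => w x * f (φ x)) =ᵐ[ν] fun x => w x * g (φ x) := by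
  filter_upwards [h.ae_comp hfg] with x hx
  by_cases hw : w x = 0
  · simp [hw]
  · rw [hx hw]

theorem aestronglyMeasurable (h : IsometricWeight μ ν w φ) {f : α → ℂ}
    (hf : AEStronglyMeasurable f μ) : AEStronglyMeasurable (fun x => w x * f (φ x)) ν := by
  refine AEStronglyMeasurable.congr ?_ (h.congr hf.ae_eq_mk).symm
  exact (h.measurable_weight.mul
    (hf.stronglyMeasurable_mk.measurable.comp h.measurable_map)).aestronglyMeasurable

theorem eLpNorm_eq (h : IsometricWeight μ ν w φ) {f : α → ℂ} (hf : AEStronglyMeasurable f μ) :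
    eLpNorm (fun x => w x * f (φ x)) 2 ν = eLpNorm f 2 μ := by
  rw [eLpNorm_congr_ae (h.congr hf.ae_eq_mk), eLpNorm_congr_ae hf.ae_eq_mk]
  have hm := hf.stronglyMeasurable_mk.measurable
  generalize hf.mk f = f' at hm
  simp only [eLpNorm_eq_lintegral_rpow_enorm_toReal (p := 2) (by norm_num) (by norm_num),
    ENNReal.toReal_ofNat, ENNReal.rpow_two]
  congr 1
  conv_rhs => rw [← h.map_eq]
  rw [lintegral_map (hm.enorm.pow_const 2) h.measurable_map,
    lintegral_withDensity_eq_lintegral_mul _ (h.measurable_weight.enorm.pow_const 2)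
      (g := fun x => ‖f' (φ x)‖ₑ ^ 2) ((hm.comp h.measurable_map).enorm.pow_const 2)]
  simp [mul_pow, enorm_mul]

theorem memLp (h : IsometricWeight μ ν w φ) {f : α → ℂ} (hf : MemLp f 2 μ) :
    MemLp (fun x => w x * f (φ x)) 2 ν :=
  ⟨h.aestronglyMeasurable hf.1, by rw [h.eLpNorm_eq hf.1]; exact hf.2⟩

/-- The isometry `f ↦ w * (f ∘ φ)`. -/
def isometry (h : IsometricWeight μ ν w φ) : Lp ℂ 2 μ →ₗᵢ[ℂ] Lp ℂ 2 ν where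
  toFun f := (h.memLp (Lp.memLp f)).toLp _
  map_add' f g := by
    rw [← MemLp.toLp_add]
    refine MemLp.toLp_congr _ _ ((h.congr (Lp.coeFn_add f g)).trans (.of_forall fun x => ?_))
    simp [mul_add]
  map_smul' c f := by
    rw [RingHom.id_apply, ← MemLp.toLp_const_smul]
    refine MemLp.toLp_congr _ _ ((h.congr (Lp.coeFn_smul c f)).trans (.of_forall fun x => ?_))
    simp [mul_left_comm]
  norm_map' f := by
    change ‖(h.memLp (Lp.memLp f)).toLp _‖ = _
    rw [Lp.norm_toLp, h.eLpNorm_eq (Lp.aestronglyMeasurable f), Lp.norm_def]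

theorem coeFn_isometry (h : IsometricWeight μ ν w φ) (f : Lp ℂ 2 μ) :
    (h.isometry f : β → ℂ) =ᵐ[ν] fun x => w x * f (φ x) :=
  (h.memLp (Lp.memLp f)).coeFn_toLp

/-- Divide by the weight and extend by zero off the range of `φ`, which is `μ`-null because `μ` is a
pushforward along `φ`. No integrability is needed, and the identity holds at every point. -/
theorem exists_comp_eq (h : IsometricWeight μ ν w φ) (hφ : MeasurableEmbedding φ)
    (hw : ∀ x, w x ≠ 0) {g : β → ℂ} (hg : AEStronglyMeasurable g ν) :
    ∃ f : α → ℂ, AEStronglyMeasurable f μ ∧ ∀ x, w x * f (φ x) = g x := by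
  refine ⟨Function.extend φ (fun x => (w x)⁻¹ * g x) 0, ?_, fun x => ?_⟩
  · have h1 : Function.extend φ (fun x => (w x)⁻¹ * g x) 0 ∘ φ = fun x => (w x)⁻¹ * g x :=
      funext fun x => hφ.injective.extend_apply _ _ x
    rw [← h.map_eq, hφ.aestronglyMeasurable_map_iff, h1]
    exact (h.measurable_weight.inv.aestronglyMeasurable.mul hg).mono_ac
      (withDensity_absolutelyContinuous _ _)
  · rw [hφ.injective.extend_apply, mul_inv_cancel_left₀ (hw x)]

theorem surjective_isometry (h : IsometricWeight μ ν w φ) (hφ : MeasurableEmbedding φ)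
    (hw : ∀ x, w x ≠ 0) : Function.Surjective h.isometry := by
  intro g
  obtain ⟨f, hfm, hf⟩ := h.exists_comp_eq hφ hw (Lp.aestronglyMeasurable g)
  have hfL : MemLp f 2 μ := by
    refine ⟨hfm, ?_⟩
    rw [← h.eLpNorm_eq hfm]
    simp only [hf]
    exact Lp.eLpNorm_lt_top g
  refine ⟨hfL.toLp f, Lp.ext ?_⟩
  filter_upwards [h.coeFn_isometry (hfL.toLp f), h.congr hfL.coeFn_toLp] with x h1 h2
  rw [h1, h2, hf]

/-- The unitary operator `f ↦ w * (f ∘ φ)`. -/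
def isometryEquiv (h : IsometricWeight μ ν w φ) (hφ : MeasurableEmbedding φ)
    (hw : ∀ x, w x ≠ 0) : Lp ℂ 2 μ ≃ₗᵢ[ℂ] Lp ℂ 2 ν :=
  LinearIsometryEquiv.ofSurjective h.isometry (h.surjective_isometry hφ hw)

theorem coeFn_isometryEquiv (h : IsometricWeight μ ν w φ) (hφ : MeasurableEmbedding φ)
    (hw : ∀ x, w x ≠ 0) (f : Lp ℂ 2 μ) :
    (h.isometryEquiv hφ hw f : β → ℂ) =ᵐ[ν] fun x => w x * f (φ x) :=
  h.coeFn_isometry f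

end IsometricWeight

end WeightedComposition

/-! ### The unitary Fourier transform -/

/-- `L²` of the real line. -/
abbrev L2R : Type := Lp ℂ 2 (volume : Measure ℝ)

theorem sqrt_two_pi_ne_zero : ((Real.sqrt (2 * Real.pi) : ℝ) : ℂ) ≠ 0 := by
  exact_mod_cast (Real.sqrt_pos.2 Real.two_pi_pos).ne'

theorem measurableEmbedding_div_two_pi :
    MeasurableEmbedding (fun t : ℝ => t / (2 * Real.pi)) := by
  simp only [div_eq_mul_inv]
  exact (Homeomorph.mulRight₀ _ (inv_ne_zero Real.two_pi_pos.ne')).measurableEmbedding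

theorem isometricWeight_dilation :
    IsometricWeight (volume : Measure ℝ) volume
      (fun _ : ℝ => ((Real.sqrt (2 * Real.pi) : ℝ) : ℂ)⁻¹) (fun t => t / (2 * Real.pi)) where
  measurable_weight := measurable_const
  measurable_map := measurableEmbedding_div_two_pi.measurable
  map_eq := by
    have h0 := Real.two_pi_pos
    have h1 : ‖((Real.sqrt (2 * Real.pi) : ℝ) : ℂ)⁻¹‖ₑ ^ 2 = ENNReal.ofReal (2 * Real.pi)⁻¹ := by
      rw [← ofReal_norm, ← ENNReal.ofReal_pow (norm_nonneg _), norm_inv,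
        Complex.norm_real, Real.norm_of_nonneg (Real.sqrt_nonneg _), inv_pow, Real.sq_sqrt h0.le]
    rw [withDensity_const, h1, Measure.map_smul]
    simp only [div_eq_mul_inv]
    rw [Real.map_volume_mul_right (inv_ne_zero h0.ne'), smul_smul, inv_inv, abs_of_pos h0,
      ← ENNReal.ofReal_mul (by positivity), inv_mul_cancel₀ h0.ne', ENNReal.ofReal_one, one_smul]

/-- The unitary dilation that relates the two normalisations of the Fourier transform. -/
def dilation : L2R ≃ₗᵢ[ℂ] L2R :=
  isometricWeight_dilation.isometryEquiv measurableEmbedding_div_two_pi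
    fun _ => inv_ne_zero sqrt_two_pi_ne_zero

theorem coeFn_dilation (f : L2R) :
    (dilation f : ℝ → ℂ) =ᵐ[volume]
      fun t => ((Real.sqrt (2 * Real.pi) : ℝ) : ℂ)⁻¹ * f (t / (2 * Real.pi)) :=
  isometricWeight_dilation.coeFn_isometryEquiv _ _ f

/-- The unitary Fourier transform as a unitary operator. -/
def fourierEquiv : L2R ≃ₗᵢ[ℂ] L2R :=
  (Lp.fourierTransformₗᵢ ℝ ℂ).trans dilation

theorem coeFn_fourierEquiv (g : L2R) : (fourierEquiv g : ℝ → ℂ) =ᵐ[volume] unitaryFourier g :=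
  coeFn_dilation _

/-- The inverse of the unitary Fourier transform, for integrable functions. -/
def invFourier (k : ℝ → ℂ) (x : ℝ) : ℂ :=
  ((Real.sqrt (2 * Real.pi) : ℝ) : ℂ)⁻¹ * ∫ t : ℝ, Complex.exp (Complex.I * x * t) * k t

theorem continuous_fourierInv {k : ℝ → ℂ} (hk : Integrable k) : Continuous (𝓕⁻ k) := by
  have : 𝓕⁻ k = fun x => 𝓕 k (-x) := funext fun x => Real.fourierInv_eq_fourier_neg k x
  rw [this]
  exact (VectorFourier.fourierIntegral_continuous Real.continuous_fourierChar
    (L := innerₗ ℝ) continuous_inner hk).comp continuous_neg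

theorem integral_fourierInv_mul {k : ℝ → ℂ} (hk : Integrable k) (φ : 𝓢(ℝ, ℂ)) :
    ∫ x, 𝓕⁻ (φ : ℝ → ℂ) x * k x = ∫ x, φ x * 𝓕⁻ k x := by
  -- The inverse transform is the Fourier integral for the pairing `-innerₗ ℝ`, which is symmetric
  -- and so equals its flip.
  have h := VectorFourier.integral_fourierIntegral_smul_eq_flip (L := -innerₗ ℝ)
    (e := Real.fourierChar) (μ := volume) (ν := volume) (f := (φ : ℝ → ℂ)) (g := k)
    Real.continuous_fourierChar (continuous_inner.neg : Continuous fun p : ℝ × ℝ => -inner ℝ p.1 p.2) φ.integrable hk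
  have h2 : (-innerₗ ℝ : ℝ →ₗ[ℝ] ℝ →ₗ[ℝ] ℝ).flip = -innerₗ ℝ := by
    ext; simp
  rw [h2] at h
  exact h

/-- The inverse Fourier transform on `L²` is given by the integral for integrable functions. -/
theorem coeFn_fourierInv_Lp (k : L2R) (hk : Integrable (k : ℝ → ℂ)) :
    ((𝓕⁻ k : L2R) : ℝ → ℂ) =ᵐ[volume] 𝓕⁻ (k : ℝ → ℂ) := by
  -- Both sides are locally integrable, so test functions decide. On the `L²` side the
  -- distributional inverse transform moves to the test function; on the other side Fubini does the
  -- same.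
  apply ae_eq_of_integral_contDiff_smul_eq
  · exact (Lp.memLp _).locallyIntegrable (by norm_num)
  · exact (continuous_fourierInv hk).locallyIntegrable
  · intro g hg hgc
    have hg₁ : HasCompactSupport (Complex.ofRealCLM ∘ g) := hgc.comp_left rfl
    have hg₂ : ContDiff ℝ ∞ (Complex.ofRealCLM ∘ g) := by fun_prop
    have h1 := congrArg (fun T => T (hg₁.toSchwartzMap hg₂))
      (Lp.fourierInv_toTemperedDistribution_eq k)
    simp only [TemperedDistribution.fourierInv_apply, Lp.toTemperedDistribution_apply,
      smul_eq_mul] at h1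
    have h2 := integral_fourierInv_mul hk (hg₁.toSchwartzMap hg₂)
    rw [← SchwartzMap.fourierInv_coe, h1] at h2
    simpa using h2

theorem coeFn_fourierEquiv_symm (k : L2R) (hk : Integrable (k : ℝ → ℂ)) :
    (fourierEquiv.symm k : ℝ → ℂ) =ᵐ[volume] invFourier k := by
  obtain ⟨h, rfl⟩ := dilation.surjective k
  have h0 := Real.two_pi_pos
  have h1 : fourierEquiv.symm (dilation h) = 𝓕⁻ h := by
    change (Lp.fourierTransformₗᵢ ℝ ℂ).symm (dilation.symm (dilation h)) = _
    rw [dilation.symm_apply_apply]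
    rfl
  have hae : ∀ᵐ t : ℝ, h (t / (2 * Real.pi)) =
      ((Real.sqrt (2 * Real.pi) : ℝ) : ℂ) * dilation h t := by
    filter_upwards [coeFn_dilation h] with t ht
    rw [ht, mul_inv_cancel_left₀ sqrt_two_pi_ne_zero]
  have hi : Integrable (h : ℝ → ℂ) := by
    rw [← integrable_comp_div_iff _ h0.ne']
    exact (hk.const_mul _).congr (hae.mono fun t ht => ht.symm)
  rw [h1]
  refine (coeFn_fourierInv_Lp h hi).trans (.of_forall fun x => ?_)
  rw [Real.fourierInv_eq']
  have h2 := Measure.integral_comp_div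
    (fun s : ℝ => Complex.exp (↑(2 * Real.pi * inner ℝ s x) * Complex.I) • h s) (2 * Real.pi)
  rw [abs_of_pos h0, eq_comm, ← eq_inv_smul_iff₀ h0.ne'] at h2
  rw [h2, invFourier]
  have h3 : ∫ t : ℝ, Complex.exp (↑(2 * Real.pi * inner ℝ (t / (2 * Real.pi)) x) * Complex.I) •
      h (t / (2 * Real.pi)) = ((Real.sqrt (2 * Real.pi) : ℝ) : ℂ) *
        ∫ t : ℝ, Complex.exp (Complex.I * x * t) * dilation h t := by
    rw [← integral_const_mul]
    refine integral_congr_ae (hae.mono fun t ht => ?_)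
    have h4 : 2 * Real.pi * inner ℝ (t / (2 * Real.pi)) x = x * t := by
      simp only [RCLike.inner_apply, conj_trivial]
      field_simp
    simp only [smul_eq_mul]
    rw [ht, h4, mul_left_comm]
    congr 3
    push_cast
    ring
  rw [h3, Complex.real_smul, ← mul_assoc]
  congr 1
  rw [← mul_eq_one_iff_eq_inv₀ sqrt_two_pi_ne_zero, mul_assoc, ← Complex.ofReal_mul,
    Real.mul_self_sqrt h0.le, ← Complex.ofReal_mul, inv_mul_cancel₀ h0.ne', Complex.ofReal_one]

/-! ### The unitary map from the circle to the line -/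

theorem one_sub_I_mul_ne_zero (x : ℝ) : 1 - Complex.I * x ≠ 0 := by
  intro h
  simpa using congrArg Complex.re h

theorem one_add_I_mul_ne_zero (x : ℝ) : 1 + Complex.I * x ≠ 0 := by
  intro h
  simpa using congrArg Complex.re h

theorem add_I_ne_zero (x : ℝ) : (x : ℂ) + Complex.I ≠ 0 := by
  intro h
  simpa using congrArg Complex.im h

/-- Square `exp (i arctan x) = (1 + i x) / √(1 + x²)` and factor `1 + x² = (1 + i x) (1 - i x)`. -/
theorem toCircle_cayleyBdryInv (x : ℝ) :
    (AddCircle.toCircle (cayleyBdryInv x) : ℂ) = (1 + Complex.I * x) / (1 - Complex.I * x) := by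
  have h0 : (0 : ℝ) < 1 + x ^ 2 := by positivity
  have h1 : (Real.sqrt (1 + x ^ 2) : ℂ) ≠ 0 := by exact_mod_cast (Real.sqrt_pos.2 h0).ne'
  have h2 : (Real.sqrt (1 + x ^ 2) : ℂ) ^ 2 = 1 + x ^ 2 := by exact_mod_cast Real.sq_sqrt h0.le
  rw [cayleyBdryInv, AddCircle.toCircle_apply_mk, div_self Real.two_pi_pos.ne', one_mul,
    Circle.coe_exp, eq_div_iff (one_sub_I_mul_ne_zero x)]
  have h3 : Complex.exp (((2 * Real.arctan x : ℝ) : ℂ) * Complex.I) =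
      Complex.exp ((Real.arctan x : ℂ) * Complex.I) ^ 2 := by
    rw [← Complex.exp_nat_mul]
    congr 1
    push_cast
    ring
  rw [h3, Complex.exp_mul_I, ← Complex.ofReal_cos, ← Complex.ofReal_sin, Real.cos_arctan,
    Real.sin_arctan]
  push_cast
  field_simp
  rw [h2]
  linear_combination (1 + Complex.I * x) * (- x ^ 2) * Complex.I_sq

theorem cayley_cayleyBdryInv (x : ℝ) :
    cayley (AddCircle.toCircle (cayleyBdryInv x) : ℂ) = x := by
  have h1 := one_sub_I_mul_ne_zero x
  have h2 : 1 + (1 + Complex.I * x) / (1 - Complex.I * x) = 2 / (1 - Complex.I * x) := by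
    field_simp
    ring
  rw [toCircle_cayleyBdryInv, cayley, h2]
  field_simp
  linear_combination (- 2 * x) * Complex.I_sq

theorem cayleyBdry_cayleyBdryInv (x : ℝ) : cayleyBdry (cayleyBdryInv x) = x := by
  rw [cayleyBdry, cayley_cayleyBdryInv, Complex.ofReal_re]

theorem continuous_cayleyBdryInv : Continuous cayleyBdryInv :=
  (AddCircle.continuous_mk' _).comp (continuous_const.mul Real.continuous_arctan)

theorem measurableEmbedding_cayleyBdryInv : MeasurableEmbedding cayleyBdryInv :=
  continuous_cayleyBdryInv.measurableEmbedding
    (Function.LeftInverse.injective cayleyBdry_cayleyBdryInv)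

theorem image_two_mul_arctan :
    (fun x => 2 * Real.arctan x) '' Set.univ = Set.Ioo (-Real.pi) Real.pi := by
  ext y
  simp only [Set.image_univ, Set.mem_range, Set.mem_Ioo]
  constructor
  · rintro ⟨x, rfl⟩
    constructor <;> linarith [Real.neg_pi_div_two_lt_arctan x, Real.arctan_lt_pi_div_two x]
  · rintro ⟨h1, h2⟩
    refine ⟨Real.tan (y / 2), ?_⟩
    rw [Real.arctan_tan (by linarith) (by linarith)]
    ring

theorem enorm_halfPlane_weight_sq (x : ℝ) :
    ‖((Real.sqrt Real.pi : ℂ) * ((x : ℂ) + Complex.I))⁻¹‖ₑ ^ 2 =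
      ENNReal.ofReal (Real.pi * (1 + x ^ 2))⁻¹ := by
  rw [← ofReal_norm, ← ENNReal.ofReal_pow (norm_nonneg _), norm_inv, norm_mul,
    Complex.norm_real, Real.norm_of_nonneg (Real.sqrt_nonneg _), inv_pow, mul_pow,
    Real.sq_sqrt Real.pi_pos.le, Complex.sq_norm, Complex.normSq_apply]
  simp
  ring_nf

/-- The substitution `φ = 2 arctan x` has Jacobian `2 / (1 + x²)`. Dividing by the total length `2π`
gives `1 / (π (1 + x²))`, the squared modulus of the weight. -/
theorem isometricWeight_halfPlane :
    IsometricWeight (AddCircle.haarAddCircle : Measure T) volume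
      (fun x : ℝ => ((Real.sqrt Real.pi : ℂ) * ((x : ℂ) + Complex.I))⁻¹) cayleyBdryInv where
  measurable_weight := by fun_prop
  measurable_map := continuous_cayleyBdryInv.measurable
  map_eq := by
    have h0 := Real.two_pi_pos
    ext s hs
    have hvol : (volume : Measure T) s =
        ENNReal.ofReal (2 * Real.pi) * (AddCircle.haarAddCircle : Measure T) s := by
      rw [AddCircle.volume_eq_smul_haarAddCircle]
      rfl
    have hne : ENNReal.ofReal (2 * Real.pi) ≠ 0 := by simpa using Real.pi_pos
    rw [← ENNReal.mul_right_inj hne ENNReal.ofReal_ne_top, ← hvol,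
      ← (AddCircle.measurePreserving_mk (2 * Real.pi) (-Real.pi)).measure_preimage
        hs.nullMeasurableSet]
    -- Dropping the endpoint removes the angle `π`, that is `z = -1`, the pole of `m`.
    have hI : (volume.restrict (Set.Ioc (-Real.pi) (-Real.pi + 2 * Real.pi)) : Measure ℝ) =
        volume.restrict (Set.Ioo (-Real.pi) Real.pi) := by
      rw [show -Real.pi + 2 * Real.pi = Real.pi by ring]
      exact (Measure.restrict_congr_set Ioo_ae_eq_Ioc).symm
    have hms : MeasurableSet ((fun y : ℝ => (y : T)) ⁻¹' s) := AddCircle.measurable_mk' hs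
    rw [hI, ← lintegral_indicator_one hms, ← image_two_mul_arctan,
      lintegral_image_eq_lintegral_abs_deriv_mul (f' := fun x => 2 * (1 / (1 + x ^ 2)))
        MeasurableSet.univ
        (fun x _ => ((Real.hasDerivAt_arctan x).const_mul 2).hasDerivWithinAt)
        ((mul_right_injective₀ (two_ne_zero' ℝ)).comp Real.arctan_injective).injOn,
      Measure.map_apply continuous_cayleyBdryInv.measurable hs,
      withDensity_apply _ (continuous_cayleyBdryInv.measurable hs),
      ← lintegral_const_mul' _ _ ENNReal.ofReal_ne_top, Measure.restrict_univ,
      ← lintegral_indicator (continuous_cayleyBdryInv.measurable hs)]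
    refine lintegral_congr fun x => ?_
    simp only [enorm_halfPlane_weight_sq, ← ENNReal.ofReal_mul h0.le]
    have hx : (0 : ℝ) < 1 + x ^ 2 := by positivity
    have h2 : 2 * Real.pi * (Real.pi * (1 + x ^ 2))⁻¹ = |2 * (1 / (1 + x ^ 2))| := by
      rw [abs_of_pos (by positivity)]
      field_simp
    by_cases hxs : cayleyBdryInv x ∈ s
    · have h3 : (2 * Real.arctan x) ∈ (fun y : ℝ => (y : T)) ⁻¹' s := hxs
      rw [Set.indicator_of_mem (show x ∈ cayleyBdryInv ⁻¹' s from hxs), Set.indicator_of_mem h3,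
        h2, Pi.one_apply, mul_one]
    · have h3 : (2 * Real.arctan x) ∉ (fun y : ℝ => (y : T)) ⁻¹' s := hxs
      rw [Set.indicator_of_notMem (show x ∉ cayleyBdryInv ⁻¹' s from hxs),
        Set.indicator_of_notMem h3, mul_zero]

theorem halfPlane_weight_ne_zero (x : ℝ) :
    ((Real.sqrt Real.pi : ℂ) * ((x : ℂ) + Complex.I))⁻¹ ≠ 0 := by
  refine inv_ne_zero (mul_ne_zero ?_ (add_I_ne_zero x))
  exact_mod_cast (Real.sqrt_pos.2 Real.pi_pos).ne'

/-- The unitary map `V` from the disc to the half plane as a unitary operator. -/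
def halfPlaneEquiv : L2T ≃ₗᵢ[ℂ] L2R :=
  isometricWeight_halfPlane.isometryEquiv measurableEmbedding_cayleyBdryInv
    halfPlane_weight_ne_zero

theorem coeFn_halfPlaneEquiv (f : L2T) :
    (halfPlaneEquiv f : ℝ → ℂ) =ᵐ[volume] halfPlane f :=
  isometricWeight_halfPlane.coeFn_isometryEquiv _ _ f

theorem ae_cayleyBdryInv {p : T → Prop}
    (hp : ∀ᵐ z ∂(AddCircle.haarAddCircle : Measure T), p z) :
    ∀ᵐ x : ℝ, p (cayleyBdryInv x) := by
  filter_upwards [isometricWeight_halfPlane.ae_comp hp] with x hx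
  exact hx (halfPlane_weight_ne_zero x)

theorem ae_of_ae_cayleyBdryInv {p : T → Prop} (hp : ∀ᵐ x : ℝ, p (cayleyBdryInv x)) :
    ∀ᵐ z ∂(AddCircle.haarAddCircle : Measure T), p z := by
  rw [← isometricWeight_halfPlane.map_eq, measurableEmbedding_cayleyBdryInv.ae_map_iff]
  exact (withDensity_absolutelyContinuous _ _).ae_le hp

/-! ### Multiplication by the inner function -/

/-- The scalar inner function `z ↦ exp (i c m(z))` on the circle. -/
def innerDisc (c : ℝ) (z : T) : ℂ :=
  Complex.exp (Complex.I * c * cayleyBdry z)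

theorem innerDisc_cayleyBdryInv (c x : ℝ) :
    innerDisc c (cayleyBdryInv x) = Complex.exp (Complex.I * c * x) := by
  rw [innerDisc, cayleyBdry_cayleyBdryInv]

theorem norm_innerDisc (c : ℝ) (z : T) : ‖innerDisc c z‖ = 1 := by
  rw [innerDisc, show Complex.I * c * cayleyBdry z = ((c * cayleyBdry z : ℝ) : ℂ) * Complex.I by
    push_cast; ring]
  exact Complex.norm_exp_ofReal_mul_I _

theorem measurable_cayleyBdry : Measurable cayleyBdry := by
  unfold cayleyBdry cayley
  have h : Measurable (fun z : T => (AddCircle.toCircle z : ℂ)) :=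
    (continuous_subtype_val.comp AddCircle.continuous_toCircle).measurable
  fun_prop

theorem measurable_innerDisc (c : ℝ) : Measurable (innerDisc c) := by
  unfold innerDisc
  have := measurable_cayleyBdry
  fun_prop

theorem isometricWeight_innerDisc (c : ℝ) :
    IsometricWeight (AddCircle.haarAddCircle : Measure T) AddCircle.haarAddCircle
      (innerDisc c) id where
  measurable_weight := measurable_innerDisc c
  measurable_map := measurable_id
  map_eq := by
    have h : (fun z => ‖innerDisc c z‖ₑ ^ 2) = 1 := by
      funext z
      simp [← ofReal_norm, norm_innerDisc]
    rw [h, withDensity_one, Measure.map_id]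

theorem innerDisc_ne_zero (c : ℝ) (z : T) : innerDisc c z ≠ 0 := Complex.exp_ne_zero _

/-- Multiplication by `exp (i c m)` as a unitary operator on `L²` of the circle. -/
def mulInner (c : ℝ) : L2T ≃ₗᵢ[ℂ] L2T :=
  (isometricWeight_innerDisc c).isometryEquiv MeasurableEmbedding.id (innerDisc_ne_zero c)

theorem coeFn_mulInner (c : ℝ) (f : L2T) :
    (mulInner c f : T → ℂ) =ᵐ[AddCircle.haarAddCircle] fun z => innerDisc c z * f z :=
  (isometricWeight_innerDisc c).coeFn_isometryEquiv _ _ f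

theorem mulInner_zero : mulInner 0 = LinearIsometryEquiv.refl ℂ L2T := by
  ext1 f
  refine Lp.ext ((coeFn_mulInner 0 f).trans (.of_forall fun z => ?_))
  simp [innerDisc]

/-! ### Extension by zero -/

theorem isometricWeight_indicator (c : ℝ) :
    IsometricWeight (volIoo c) volume ((Set.Ioo 0 c).indicator 1) id where
  measurable_weight := measurable_one.indicator measurableSet_Ioo
  measurable_map := measurable_id
  map_eq := by
    have h : (fun x => ‖(Set.Ioo 0 c).indicator (1 : ℝ → ℂ) x‖ₑ ^ 2) =
        (Set.Ioo 0 c).indicator 1 := by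
      funext x
      by_cases hx : x ∈ Set.Ioo 0 c <;> simp [hx]
    rw [h, withDensity_indicator_one measurableSet_Ioo, Measure.map_id]

/-- Extension by zero from `L²(0, c)` to `L²` of the line. -/
def extendZero (c : ℝ) : Lp ℂ 2 (volIoo c) →ₗᵢ[ℂ] L2R :=
  (isometricWeight_indicator c).isometry

theorem coeFn_extendZero (c : ℝ) (k : Lp ℂ 2 (volIoo c)) :
    (extendZero c k : ℝ → ℂ) =ᵐ[volume] (Set.Ioo 0 c).indicator k := by
  refine ((isometricWeight_indicator c).coeFn_isometry k).trans (.of_forall fun x => ?_)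
  by_cases hx : x ∈ Set.Ioo 0 c <;> simp [hx]

/-! ### Inverse Fourier transforms of functions supported in a half line -/

/-- The function `g` is, up to normalisation, the inverse Fourier transform of a function in
`L¹ ∩ L²` that vanishes outside `S`. -/
def IsInvFourierOn (S : Set ℝ) (g : ℝ → ℂ) : Prop :=
  ∃ K : ℝ → ℂ, Integrable K ∧ MemLp K 2 ∧ (∀ t, t ∉ S → K t = 0) ∧
    ∀ x : ℝ, ∫ t : ℝ, Complex.exp (Complex.I * x * t) * K t = g x

theorem integrable_exp_mul {K : ℝ → ℂ} (hK : Integrable K) (x : ℝ) :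
    Integrable fun t : ℝ => Complex.exp (Complex.I * x * t) * K t := by
  refine hK.bdd_mul (c := 1) (by fun_prop) (.of_forall fun t => ?_)
  rw [show Complex.I * x * t = ((x * t : ℝ) : ℂ) * Complex.I by push_cast; ring,
    Complex.norm_exp_ofReal_mul_I]

namespace IsInvFourierOn

variable {S : Set ℝ} {g h : ℝ → ℂ}

theorem congr (hg : IsInvFourierOn S g) (hgh : ∀ x, g x = h x) : IsInvFourierOn S h := by
  rwa [← funext hgh]

theorem const_mul (hg : IsInvFourierOn S g) (r : ℂ) : IsInvFourierOn S fun x => r * g x := by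
  obtain ⟨K, h1, h2, h3, h4⟩ := hg
  refine ⟨fun t => r * K t, h1.const_mul r, h2.const_mul r, fun t ht => by simp [h3 t ht],
    fun x => ?_⟩
  simp only
  rw [← h4 x, ← integral_const_mul]
  simp only [mul_left_comm]

theorem sub (hg : IsInvFourierOn S g) (hh : IsInvFourierOn S h) :
    IsInvFourierOn S fun x => g x - h x := by
  obtain ⟨K, h1, h2, h3, h4⟩ := hg
  obtain ⟨L, k1, k2, k3, k4⟩ := hh
  refine ⟨fun t => K t - L t, h1.sub k1, h2.sub k2, fun t ht => by simp [h3 t ht, k3 t ht],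
    fun x => ?_⟩
  simp only
  rw [← h4 x, ← k4 x, ← integral_sub (integrable_exp_mul h1 x) (integrable_exp_mul k1 x)]
  simp only [mul_sub]

theorem neg_arg (hg : IsInvFourierOn S g) :
    IsInvFourierOn ((fun t => -t) ⁻¹' S) fun x => g (-x) := by
  obtain ⟨K, h1, h2, h3, h4⟩ := hg
  refine ⟨fun t => K (-t), h1.comp_neg,
    h2.comp_measurePreserving (Measure.measurePreserving_neg volume), fun t ht => h3 _ ht,
    fun x => ?_⟩
  simp only
  rw [← h4, ← integral_neg_eq_self]
  simp

theorem exp_mul (hg : IsInvFourierOn S g) (c : ℝ) :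
    IsInvFourierOn ((fun t => t - c) ⁻¹' S) fun x => Complex.exp (Complex.I * c * x) * g x := by
  obtain ⟨K, h1, h2, h3, h4⟩ := hg
  refine ⟨fun t => K (t - c), h1.comp_sub_right c,
    h2.comp_measurePreserving (measurePreserving_sub_right volume c), fun t ht => h3 _ ht,
    fun x => ?_⟩
  simp only
  rw [← h4, ← integral_const_mul, ← integral_sub_right_eq_self
    (fun t : ℝ => Complex.exp (Complex.I * c * x) * (Complex.exp (Complex.I * x * t) * K t)) c]
  refine integral_congr_ae (.of_forall fun t => ?_)
  simp only
  rw [← mul_assoc, ← Complex.exp_add]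
  congr 2
  push_cast
  ring

end IsInvFourierOn

theorem integrableOn_pow_mul_exp (n : ℕ) {b : ℝ} (hb : 0 < b) :
    IntegrableOn (fun t : ℝ => t ^ n * Real.exp (-b * t)) (Set.Ioi 0) := by
  refine (integrableOn_rpow_mul_exp_neg_mul_rpow (s := n) (p := 1) (b := b)
    (by linarith [(Nat.cast_nonneg n : (0 : ℝ) ≤ n)]) one_pos hb).congr_fun
    (fun t _ => ?_) measurableSet_Ioi
  simp

theorem norm_cexp_one_sub_I_mul (x t : ℝ) :
    ‖Complex.exp (-((1 - Complex.I * x) * t))‖ = Real.exp (-1 * t) := by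
  rw [Complex.norm_exp]
  simp

theorem integrableOn_pow_mul_cexp (n : ℕ) (x : ℝ) :
    IntegrableOn (fun t : ℝ => (t : ℂ) ^ n * Complex.exp (-((1 - Complex.I * x) * t)))
      (Set.Ioi 0) := by
  refine (integrableOn_pow_mul_exp n one_pos).mono' (by fun_prop) ?_
  refine (ae_restrict_iff' measurableSet_Ioi).2 (.of_forall fun t ht => ?_)
  rw [norm_mul, norm_cexp_one_sub_I_mul, norm_pow, Complex.norm_real,
    Real.norm_of_nonneg (le_of_lt ht)]

/-- Integration by parts, in the form that the derivative of `t ^ (n + 1) exp (-(1 - i x) t)` has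
integral zero over the half line. -/
theorem integral_pow_mul_cexp (n : ℕ) (x : ℝ) :
    ∫ t : ℝ in Set.Ioi 0, (t : ℂ) ^ n * Complex.exp (-((1 - Complex.I * x) * t)) =
      n.factorial * ((1 - Complex.I * x) ^ (n + 1))⁻¹ := by
  have hr := one_sub_I_mul_ne_zero x
  induction n with
  | zero =>
    have h := integral_exp_mul_complex_Ioi (a := -(1 - Complex.I * x)) (by simp) 0
    simp only [pow_zero, one_mul, ← neg_mul]
    rw [h]
    simp only [Complex.ofReal_zero, mul_zero, Complex.exp_zero, neg_div_neg_eq]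
    simp
  | succ n ih =>
    have hd : ∀ t : ℝ, HasDerivAt
        (fun t : ℝ => (t : ℂ) ^ (n + 1) * Complex.exp (-((1 - Complex.I * x) * t)))
        ((n + 1) * ((t : ℂ) ^ n * Complex.exp (-((1 - Complex.I * x) * t))) -
          (1 - Complex.I * x) *
            ((t : ℂ) ^ (n + 1) * Complex.exp (-((1 - Complex.I * x) * t)))) t := fun t => by
      have h1 : HasDerivAt (fun s : ℝ => (s : ℂ)) 1 t := Complex.ofRealCLM.hasDerivAt
      have h2 := (h1.pow (n + 1)).mul ((h1.const_mul (1 - Complex.I * x)).neg.cexp)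
      refine h2.congr_deriv ?_
      simp only [Nat.add_sub_cancel, Pi.pow_apply, Pi.neg_apply]
      push_cast
      ring
    have hlim : Filter.Tendsto
        (fun t : ℝ => (t : ℂ) ^ (n + 1) * Complex.exp (-((1 - Complex.I * x) * t)))
        Filter.atTop (nhds 0) := by
      rw [tendsto_zero_iff_norm_tendsto_zero]
      refine (Real.tendsto_pow_mul_exp_neg_atTop_nhds_zero (n + 1)).congr' ?_
      filter_upwards [Filter.eventually_ge_atTop 0] with t ht
      rw [norm_mul, norm_cexp_one_sub_I_mul, norm_pow, Complex.norm_real,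
        Real.norm_of_nonneg ht, neg_one_mul]
    have i1 := (integrableOn_pow_mul_cexp n x).const_mul ((n : ℂ) + 1)
    have i2 := (integrableOn_pow_mul_cexp (n + 1) x).const_mul (1 - Complex.I * x)
    have h := integral_Ioi_of_hasDerivAt_of_tendsto' (a := 0) (fun t _ => hd t) (i1.sub i2) hlim
    rw [integral_sub i1 i2, integral_const_mul, integral_const_mul, ih] at h
    simp only [Complex.ofReal_zero, ne_eq, Nat.add_eq_zero_iff, one_ne_zero, and_false,
      not_false_eq_true, zero_pow, zero_mul, sub_zero] at h
    rw [sub_eq_zero, ← inv_mul_eq_iff_eq_mul₀ hr] at h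
    rw [← h, Nat.factorial_succ, pow_succ _ (n + 1), mul_inv]
    push_cast
    ring

theorem isInvFourierOn_inv_pow (m : ℕ) :
    IsInvFourierOn (Set.Ioi 0) fun x : ℝ => ((1 - Complex.I * x) ^ (m + 1))⁻¹ := by
  have key : IsInvFourierOn (Set.Ioi 0)
      fun x : ℝ => (m.factorial : ℂ) * ((1 - Complex.I * x) ^ (m + 1))⁻¹ := by
    have hm : Measurable ((Set.Ioi (0 : ℝ)).indicator
        fun t : ℝ => ((t ^ m * Real.exp (-1 * t) : ℝ) : ℂ)) :=
      Measurable.indicator (by fun_prop) measurableSet_Ioi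
    refine ⟨(Set.Ioi 0).indicator fun t : ℝ => ((t ^ m * Real.exp (-1 * t) : ℝ) : ℂ), ?_, ?_,
      fun t ht => Set.indicator_of_notMem ht _, fun x => ?_⟩
    · rw [integrable_indicator_iff measurableSet_Ioi]
      exact (integrableOn_pow_mul_exp m one_pos).ofReal
    · rw [memLp_two_iff_integrable_sq_norm hm.aestronglyMeasurable]
      have h1 := (integrable_indicator_iff measurableSet_Ioi).2 (integrableOn_pow_mul_exp (2 * m) two_pos)
      refine h1.congr (.of_forall fun t => ?_)
      by_cases ht : t ∈ Set.Ioi (0 : ℝ)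
      · simp only [Set.indicator_of_mem ht]
        rw [Complex.norm_real, Real.norm_eq_abs, sq_abs, mul_pow, ← Real.exp_nat_mul, ← pow_mul]
        push_cast
        ring_nf
      · simp only [Set.indicator_of_notMem ht]
        simp
    · simp only
      rw [← integral_pow_mul_cexp, ← integral_indicator measurableSet_Ioi]
      refine integral_congr_ae (.of_forall fun t => ?_)
      by_cases ht : t ∈ Set.Ioi (0 : ℝ)
      · simp only [Set.indicator_of_mem ht]
        push_cast
        rw [mul_left_comm, ← Complex.exp_add]
        ring_nf
      · simp only [Set.indicator_of_notMem ht]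
        simp
  refine (key.const_mul (m.factorial : ℂ)⁻¹).congr fun x => ?_
  rw [inv_mul_cancel_left₀ (by exact_mod_cast m.factorial_ne_zero)]

/-- Writing `1 + i x = 2 - (1 - i x)` trades one factor of the numerator for two terms with smaller
`n`. These have different `m`, so `m` is free in the induction. -/
theorem isInvFourierOn_div_pow (n m : ℕ) :
    IsInvFourierOn (Set.Ioi 0)
      fun x : ℝ => (1 + Complex.I * x) ^ n * ((1 - Complex.I * x) ^ (n + m + 1))⁻¹ := by
  induction n generalizing m with
  | zero => simpa using isInvFourierOn_inv_pow m
  | succ n ih =>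
    refine (((ih (m + 1)).const_mul 2).sub (ih m)).congr fun x => ?_
    have h := one_sub_I_mul_ne_zero x
    rw [show n + 1 + m + 1 = n + m + 1 + 1 by ring, show n + (m + 1) + 1 = n + m + 1 + 1 by ring,
      pow_succ _ (n + m + 1), pow_succ _ n]
    field_simp
    ring

theorem isInvFourierOn_Ioi (c : ℝ) (n : ℕ) :
    IsInvFourierOn (Set.Ioi c) fun x : ℝ => Complex.exp (Complex.I * c * x) *
      ((1 + Complex.I * x) ^ n * ((1 - Complex.I * x) ^ (n + 1))⁻¹) := by
  have h := (isInvFourierOn_div_pow n 0).exp_mul c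
  simpa using h

/-- The reflection `x ↦ -x` exchanges the two kinds of half line. -/
theorem isInvFourierOn_Iio (c : ℝ) (n : ℕ) :
    IsInvFourierOn (Set.Iio c) fun x : ℝ => Complex.exp (Complex.I * c * x) *
      ((1 - Complex.I * x) ^ n * ((1 + Complex.I * x) ^ (n + 1))⁻¹) := by
  have h := (isInvFourierOn_Ioi (-c) n).neg_arg
  simpa [sub_eq_add_neg] using h

theorem invFourier_congr_ae {k l : ℝ → ℂ} (h : k =ᵐ[volume] l) : invFourier k = invFourier l := by
  funext x
  rw [invFourier, invFourier]
  congr 1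
  refine integral_congr_ae (h.mono fun t ht => ?_)
  simp only [ht]

theorem IsInvFourierOn.fourierEquiv_eq_zero {S : Set ℝ} {g : ℝ → ℂ} (hg : IsInvFourierOn S g)
    {f : L2R} (hf : (f : ℝ → ℂ) =ᵐ[volume] g) : ∀ᵐ t, t ∉ S → fourierEquiv f t = 0 := by
  obtain ⟨K, h1, h2, h3, h4⟩ := hg.const_mul ((Real.sqrt (2 * Real.pi) : ℝ) : ℂ)
  have h5 : fourierEquiv.symm (h2.toLp K) = f := by
    refine Lp.ext ?_
    refine (coeFn_fourierEquiv_symm _ (h1.congr h2.coeFn_toLp.symm)).trans ?_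
    rw [invFourier_congr_ae h2.coeFn_toLp]
    filter_upwards [hf] with x hx
    rw [invFourier, h4, hx, inv_mul_cancel_left₀ sqrt_two_pi_ne_zero]
  rw [← h5, fourierEquiv.apply_symm_apply]
  filter_upwards [h2.coeFn_toLp] with t ht hS
  rw [ht, h3 t hS]

/-! ### The images of the trigonometric basis -/

/-- The unitary operator `𝓕 ∘ V`. -/
def fourierHalfPlane : L2T ≃ₗᵢ[ℂ] L2R := halfPlaneEquiv.trans fourierEquiv

theorem coeFn_halfPlaneEquiv_mulInner_fourier (c : ℝ) (n : ℤ) :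
    (halfPlaneEquiv (mulInner c (fourierLp 2 n)) : ℝ → ℂ) =ᵐ[volume] fun x =>
      ((Real.sqrt Real.pi : ℂ) * ((x : ℂ) + Complex.I))⁻¹ * (Complex.exp (Complex.I * c * x) *
        ((1 + Complex.I * x) / (1 - Complex.I * x)) ^ n) := by
  filter_upwards [coeFn_halfPlaneEquiv (mulInner c (fourierLp 2 n)),
    ae_cayleyBdryInv (coeFn_mulInner c (fourierLp 2 n)),
    ae_cayleyBdryInv (coeFn_fourierLp (T := 2 * Real.pi) 2 n)] with x h1 h2 h3
  rw [h1, halfPlane, h2, h3, innerDisc_cayleyBdryInv, fourier_apply, AddCircle.toCircle_zsmul,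
    Circle.coe_zpow, toCircle_cayleyBdryInv]

theorem add_I_eq (x : ℝ) : (x : ℂ) + Complex.I = Complex.I * (1 - Complex.I * x) := by
  linear_combination (x : ℂ) * Complex.I_sq

theorem fourierHalfPlane_basis_nonneg (c : ℝ) {n : ℤ} (hn : 0 ≤ n) :
    ∀ᵐ t, t ∉ Set.Ioi c → fourierHalfPlane (mulInner c (fourierLp 2 n)) t = 0 := by
  obtain ⟨m, rfl⟩ := Int.eq_ofNat_of_zero_le hn
  refine ((isInvFourierOn_Ioi c m).const_mul ((Real.sqrt Real.pi : ℂ) * Complex.I)⁻¹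
    ).fourierEquiv_eq_zero
    ((coeFn_halfPlaneEquiv_mulInner_fourier c m).trans (.of_forall fun x => ?_))
  have h := one_sub_I_mul_ne_zero x
  simp only
  rw [add_I_eq, zpow_natCast, div_pow, pow_succ _ m, ← mul_assoc _ Complex.I, mul_inv, mul_inv,
    mul_inv]
  ring

/-- For `n = -(m + 1)` the weight `(x + i)⁻¹` cancels one of the `m + 1` factors `1 - i x` in the
numerator, so the only pole left is in the other half plane. This is why the split falls between
`-1` and `0`. -/
theorem fourierHalfPlane_basis_neg (c : ℝ) {n : ℤ} (hn : n < 0) :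
    ∀ᵐ t, t ∉ Set.Iio c → fourierHalfPlane (mulInner c (fourierLp 2 n)) t = 0 := by
  obtain ⟨m, rfl⟩ := Int.eq_negSucc_of_lt_zero hn
  refine ((isInvFourierOn_Iio c m).const_mul ((Real.sqrt Real.pi : ℂ) * Complex.I)⁻¹
    ).fourierEquiv_eq_zero
    ((coeFn_halfPlaneEquiv_mulInner_fourier c _).trans (.of_forall fun x => ?_))
  have h := one_sub_I_mul_ne_zero x
  have h' := one_add_I_mul_ne_zero x
  simp only
  rw [add_I_eq, zpow_negSucc, div_pow, ← mul_assoc _ Complex.I, inv_div, pow_succ (1 - _) m,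
    mul_inv _ (1 - Complex.I * (x : ℂ))]
  field_simp

/-- If a total family splits into functions supported in `S` and functions supported in the
complement, then the functions supported in `S` are those orthogonal to the second part. -/
theorem ae_eq_zero_off_iff_of_total {ι : Type*} {e : ι → L2R} {P : ι → Prop} {S : Set ℝ}
    (hS : MeasurableSet S) (htot : ∀ f : L2R, (∀ n, inner ℂ (e n) f = 0) → f = 0)
    (h1 : ∀ n, P n → ∀ᵐ t, t ∉ S → e n t = 0) (h2 : ∀ n, ¬ P n → ∀ᵐ t, t ∈ S → e n t = 0)
    (f : L2R) :
    (∀ᵐ t, t ∉ S → f t = 0) ↔ ∀ n, ¬ P n → inner ℂ (e n) f = 0 := by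
  constructor
  · intro hf n hn
    rw [L2.inner_def]
    refine integral_eq_zero_of_ae ?_
    filter_upwards [hf, h2 n hn] with t ht1 ht2
    by_cases ht : t ∈ S
    · simp [ht2 ht]
    · simp [ht1 ht]
  · intro hf
    -- The part of `f` off `S` is orthogonal to every member of the family: to the first kind by
    -- disjoint supports, to the second because there it has the same inner product as `f`.
    have hmem : MemLp (Sᶜ.indicator f) 2 volume := (Lp.memLp f).indicator hS.compl
    have h0 : hmem.toLp _ = 0 := by
      refine htot _ fun n => ?_
      by_cases hn : P n
      · rw [L2.inner_def]
        refine integral_eq_zero_of_ae ?_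
        filter_upwards [h1 n hn, hmem.coeFn_toLp] with t ht1 ht2
        by_cases ht : t ∈ S
        · simp [ht2, ht]
        · simp [ht1 ht]
      · rw [← hf n hn, L2.inner_def, L2.inner_def]
        refine integral_congr_ae ?_
        filter_upwards [h2 n hn, hmem.coeFn_toLp] with t ht1 ht2
        by_cases ht : t ∈ S
        · simp [ht1 ht]
        · simp [ht2, ht]
    have h3 := hmem.coeFn_toLp
    rw [h0] at h3
    filter_upwards [h3, Lp.coeFn_zero ℂ 2 (volume : Measure ℝ)] with t ht1 ht2 ht
    rw [ht2] at ht1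
    simpa [ht] using ht1.symm

theorem inner_fourierHalfPlane_basis (c : ℝ) (n : ℤ) (f : L2T) :
    inner ℂ (fourierHalfPlane (mulInner c (fourierLp 2 n))) (fourierHalfPlane f) =
      fourierCoeff ((mulInner c).symm f : T → ℂ) n := by
  rw [LinearIsometryEquiv.inner_map_map, ← fourierBasis_repr, HilbertBasis.repr_apply_apply,
    coe_fourierBasis]
  conv_lhs => rw [← (mulInner c).apply_symm_apply f]
  rw [LinearIsometryEquiv.inner_map_map]

theorem total_fourierHalfPlane_basis (c : ℝ) (f : L2R)
    (hf : ∀ n : ℤ, inner ℂ (fourierHalfPlane (mulInner c (fourierLp 2 n))) f = 0) : f = 0 := by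
  obtain ⟨f, rfl⟩ := fourierHalfPlane.surjective f
  obtain ⟨f, rfl⟩ := (mulInner c).surjective f
  simp only [inner_fourierHalfPlane_basis, (mulInner c).symm_apply_apply,
    ← fourierBasis_repr] at hf
  have : fourierBasis.repr f = 0 := lp.ext (funext hf)
  rw [LinearIsometryEquiv.map_eq_zero_iff] at this
  simp [this]

/-- The Paley-Wiener theorem for `exp (i c m) H²`; the case `c = 0` is `H²` itself. -/
theorem fourierCoeff_neg_eq_zero_iff (c : ℝ) (f : L2T) :
    (∀ n : ℤ, n < 0 → fourierCoeff ((mulInner c).symm f : T → ℂ) n = 0) ↔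
      ∀ᵐ t, t ∉ Set.Ioi c → fourierHalfPlane f t = 0 := by
  rw [ae_eq_zero_off_iff_of_total (P := fun n : ℤ => 0 ≤ n) measurableSet_Ioi
    (total_fourierHalfPlane_basis c) (fun n hn => fourierHalfPlane_basis_nonneg c hn)]
  · simp only [inner_fourierHalfPlane_basis, not_le]
  · intro n hn
    filter_upwards [fourierHalfPlane_basis_neg c (not_le.1 hn)] with t ht hS
    exact ht (not_lt.2 (le_of_lt (Set.mem_Ioi.1 hS)))

theorem fourierCoeff_nonneg_eq_zero_iff (c : ℝ) (f : L2T) :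
    (∀ n : ℤ, 0 ≤ n → fourierCoeff ((mulInner c).symm f : T → ℂ) n = 0) ↔
      ∀ᵐ t, t ∉ Set.Iio c → fourierHalfPlane f t = 0 := by
  rw [ae_eq_zero_off_iff_of_total (P := fun n : ℤ => n < 0) measurableSet_Iio
    (total_fourierHalfPlane_basis c) (fun n hn => fourierHalfPlane_basis_neg c hn)]
  · simp only [inner_fourierHalfPlane_basis, not_lt]
  · intro n hn
    filter_upwards [fourierHalfPlane_basis_nonneg c (not_lt.1 hn)] with t ht hS
    exact ht (not_lt.2 (le_of_lt (Set.mem_Iio.1 hS)))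

/-! ### The model space and its image -/

/-- On the range of `m⁻¹` the value of `m` is real, so replacing it by its real part in `innerDisc`
changes nothing. The rest of the circle is null. -/
theorem ae_diagInnerDisc (a b : ℝ) : ∀ᵐ z ∂(AddCircle.haarAddCircle : Measure T),
    ∀ i j, diagInnerDisc a b z i j = if i = j then innerDisc ((![a, b] : Fin 2 → ℝ) i) z else 0 := by
  refine ae_of_ae_cayleyBdryInv (.of_forall fun x i j => ?_)
  rw [innerDisc_cayleyBdryInv, diagInnerDisc, diagInner, cayley_cayleyBdryInv,
    Matrix.diagonal_apply]
  fin_cases i <;> rfl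

theorem fourierCoeff_star (f : L2T) (n : ℤ) :
    fourierCoeff ((star f : L2T) : T → ℂ) n = conj (fourierCoeff (f : T → ℂ) (-n)) := by
  rw [fourierCoeff, fourierCoeff, ← integral_conj]
  refine integral_congr_ae ?_
  filter_upwards [Lp.coeFn_star f] with z hz
  rw [hz]
  simp

theorem mem_hardy_iff (f : L2T) :
    f ∈ hardy ↔ ∀ᵐ t, t ∉ Set.Ioi (0 : ℝ) → fourierHalfPlane f t = 0 := by
  rw [← fourierCoeff_neg_eq_zero_iff, mulInner_zero]
  rfl

theorem mem_hardyZero_iff (f : L2T) :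
    f ∈ hardyZero ↔ ∀ n : ℤ, 0 ≤ n → fourierCoeff ((star f : L2T) : T → ℂ) n = 0 := by
  simp only [fourierCoeff_star, map_eq_zero]
  constructor
  · rintro ⟨h1, h2⟩ n hn
    rcases hn.eq_or_lt with rfl | hn
    · simpa using h2
    · exact h1 _ (neg_lt_zero.2 hn)
  · intro h
    exact ⟨fun n hn => by simpa using h (-n) (neg_nonneg.2 hn.le), by simpa using h 0 le_rfl⟩

/-- As `Θ` is diagonal and unimodular, the condition `f = Θ conj g` says entry by entry that `Θ⁻¹ f`
has no coefficients with `n ≥ 0`. It bounds the support above by the interval length, and `f ∈ H²`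
bounds it below by `0`. -/
theorem mem_modelSpace_diagInnerDisc_iff (a b : ℝ) (f : L2T2) :
    f ∈ modelSpace (diagInnerDisc a b) ↔
      ∀ i, ∀ᵐ t, t ∉ Set.Ioo 0 ((![a, b] : Fin 2 → ℝ) i) → fourierHalfPlane (f i) t = 0 := by
  have key : f ∈ modelSpace (diagInnerDisc a b) ↔ ∀ i, f i ∈ hardy ∧
      ∀ n : ℤ, 0 ≤ n →
        fourierCoeff ((mulInner ((![a, b] : Fin 2 → ℝ) i)).symm (f i) : T → ℂ) n = 0 := by
    constructor
    · rintro ⟨h1, g, hg, hfg⟩ i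
      refine ⟨h1 i, ?_⟩
      have h2 : mulInner ((![a, b] : Fin 2 → ℝ) i) (star (g i)) = f i := by
        refine Lp.ext ?_
        filter_upwards [coeFn_mulInner ((![a, b] : Fin 2 → ℝ) i) (star (g i)), hfg i,
          ae_diagInnerDisc a b, Lp.coeFn_star (g i)] with z h3 h4 h5 h6
        rw [h3, h4, h6]
        simp [h5]
      rw [← h2, LinearIsometryEquiv.symm_apply_apply]
      exact (mem_hardyZero_iff _).1 (hg i)
    · intro h
      refine ⟨fun i => (h i).1, WithLp.toLp 2 fun i =>
        star ((mulInner ((![a, b] : Fin 2 → ℝ) i)).symm (f i)), fun i => ?_, fun i => ?_⟩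
      · rw [mem_hardyZero_iff]
        simpa using (h i).2
      · have h2 := coeFn_mulInner ((![a, b] : Fin 2 → ℝ) i)
          ((mulInner ((![a, b] : Fin 2 → ℝ) i)).symm (f i))
        rw [LinearIsometryEquiv.apply_symm_apply] at h2
        filter_upwards [h2, ae_diagInnerDisc a b,
          Lp.coeFn_star ((mulInner ((![a, b] : Fin 2 → ℝ) i)).symm (f i))] with z h3 h5 h6
        rw [h3]
        simp [h5, h6]
  rw [key]
  refine forall_congr' fun i => ?_
  rw [mem_hardy_iff, fourierCoeff_nonneg_eq_zero_iff, ← Filter.eventually_and]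
  refine Filter.eventually_congr (.of_forall fun t => ?_)
  simp only [Set.mem_Ioi, Set.mem_Iio, Set.mem_Ioo]
  tauto

theorem exists_extendZero_eq {c : ℝ} {f : L2R} (hf : ∀ᵐ t, t ∉ Set.Ioo 0 c → f t = 0) :
    ∃ k, extendZero c k = f := by
  have hm : MemLp f 2 (volIoo c) := (Lp.memLp f).restrict _
  refine ⟨hm.toLp _, Lp.ext ?_⟩
  filter_upwards [coeFn_extendZero c (hm.toLp _), hf,
    (ae_restrict_iff' measurableSet_Ioo).1 hm.coeFn_toLp] with t h1 h2 h3
  rw [h1]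
  by_cases ht : t ∈ Set.Ioo 0 c
  · rw [Set.indicator_of_mem ht, h3 ht]
  · rw [Set.indicator_of_notMem ht, h2 ht]

theorem extendZero_eq_zero_off {c : ℝ} (k : Lp ℂ 2 (volIoo c)) :
    ∀ᵐ t, t ∉ Set.Ioo 0 c → extendZero c k t = 0 := by
  filter_upwards [coeFn_extendZero c k] with t h1 h2
  rw [h1, Set.indicator_of_notMem h2]

theorem coeFn_extendZero_restrict {c : ℝ} (k : Lp ℂ 2 (volIoo c)) :
    (k : ℝ → ℂ) =ᵐ[volIoo c] extendZero c k := by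
  refine (ae_restrict_iff' measurableSet_Ioo).2 ?_
  filter_upwards [coeFn_extendZero c k] with t h1 h2
  rw [h1, Set.indicator_of_mem h2]

/-- The inverse of `𝓕 ∘ V` on the columns of functions on the two intervals. -/
def intervalsToCircle (a b : ℝ) : L2Intervals a b →ₗᵢ[ℂ] L2T2 where
  toFun k := WithLp.toLp 2 fun i =>
    fourierHalfPlane.symm (extendZero ((![a, b] : Fin 2 → ℝ) i) (k i))
  map_add' k l := by ext1 i; simp
  map_smul' r k := by ext1 i; simp
  norm_map' k := by
    rw [← sq_eq_sq₀ (norm_nonneg _) (norm_nonneg _)]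
    simp [PiLp.norm_sq_eq_of_L2]

theorem intervalsToCircle_apply (a b : ℝ) (k : L2Intervals a b) (i : Fin 2) :
    intervalsToCircle a b k i =
      fourierHalfPlane.symm (extendZero ((![a, b] : Fin 2 → ℝ) i) (k i)) := rfl

theorem range_intervalsToCircle (a b : ℝ) :
    (intervalsToCircle a b).toLinearMap.range = modelSpace (diagInnerDisc a b) := by
  ext f
  rw [mem_modelSpace_diagInnerDisc_iff]
  constructor
  · rintro ⟨k, rfl⟩ i
    change ∀ᵐ t, _ → fourierHalfPlane (intervalsToCircle a b k i) t = 0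
    rw [intervalsToCircle_apply, LinearIsometryEquiv.apply_symm_apply]
    exact extendZero_eq_zero_off _
  · intro h
    choose k hk using fun i => exists_extendZero_eq (h i)
    refine ⟨WithLp.toLp 2 k, ?_⟩
    ext1 i
    change intervalsToCircle a b (WithLp.toLp 2 k) i = f i
    rw [intervalsToCircle_apply]
    simp [hk]

/-- The restriction of `𝓕 ∘ V` to a unitary map of the model space onto the `L²` space of the two
intervals. -/
def modelEquiv (a b : ℝ) : modelSpace (diagInnerDisc a b) ≃ₗᵢ[ℂ] L2Intervals a b :=
  ((intervalsToCircle a b).equivRange.trans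
    (LinearIsometryEquiv.ofEq _ _ (range_intervalsToCircle a b))).symm

theorem coe_modelEquiv_symm (a b : ℝ) (k : L2Intervals a b) :
    ((modelEquiv a b).symm k : L2T2) = intervalsToCircle a b k := rfl

theorem extendZero_modelEquiv (a b : ℝ) (f : modelSpace (diagInnerDisc a b)) (i : Fin 2) :
    extendZero ((![a, b] : Fin 2 → ℝ) i) (modelEquiv a b f i) =
      fourierHalfPlane ((f : L2T2) i) := by
  obtain ⟨k, rfl⟩ := (modelEquiv a b).symm.surjective f
  rw [LinearIsometryEquiv.apply_symm_apply, coe_modelEquiv_symm, intervalsToCircle_apply,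
    LinearIsometryEquiv.apply_symm_apply]

theorem modelEquiv_spec (a b : ℝ) (f : modelSpace (diagInnerDisc a b)) (i : Fin 2) :
    ∃ g : Lp ℂ 2 (volume : Measure ℝ),
      (g : ℝ → ℂ) =ᵐ[volume] halfPlane ((f : L2T2) i : T → ℂ) ∧
      (modelEquiv a b f i : ℝ → ℂ) =ᵐ[volIoo ((![a, b] : Fin 2 → ℝ) i)] unitaryFourier g ∧
      ∀ᵐ t, t ∉ Set.Ioo 0 ((![a, b] : Fin 2 → ℝ) i) → unitaryFourier g t = 0 := by
  refine ⟨halfPlaneEquiv ((f : L2T2) i), coeFn_halfPlaneEquiv _, ?_, ?_⟩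
  · have h := coeFn_extendZero_restrict (modelEquiv a b f i)
    rw [extendZero_modelEquiv] at h
    exact h.trans (ae_restrict_of_ae (coeFn_fourierEquiv _))
  · filter_upwards [(mem_modelSpace_diagInnerDisc_iff a b f).1 f.2 i,
      coeFn_fourierEquiv (halfPlaneEquiv ((f : L2T2) i))] with t h1 h2 ht
    rw [← h2]
    exact h1 ht

/-! ### Test functions -/

/-- Real test functions on the interval `(0, c)`. -/
structure IsTest (c : ℝ) (l : ℝ → ℝ) : Prop where
  contDiff : ContDiff ℝ ∞ l
  hasCompactSupport : HasCompactSupport l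
  tsupport_subset : tsupport l ⊆ Set.Ioo 0 c

namespace IsTest

variable {c : ℝ} {l : ℝ → ℝ}

theorem eq_zero (hl : IsTest c l) {t : ℝ} (ht : t ∉ Set.Ioo 0 c) : l t = 0 :=
  image_eq_zero_of_notMem_tsupport fun h => ht (hl.tsupport_subset h)

/-- A test function as a Schwartz function. -/
def toSchwartz (hl : IsTest c l) : 𝓢(ℝ, ℂ) :=
  HasCompactSupport.toSchwartzMap (f := Complex.ofRealCLM ∘ l) (hl.hasCompactSupport.comp_left rfl)
    (Complex.ofRealCLM.contDiff.comp hl.contDiff)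

theorem toSchwartz_apply (hl : IsTest c l) (t : ℝ) : hl.toSchwartz t = (l t : ℂ) := rfl

theorem integrable (hl : IsTest c l) : Integrable (fun t => (l t : ℂ)) := hl.toSchwartz.integrable

theorem memLp (hl : IsTest c l) (p : ENNReal) : MemLp (fun t => (l t : ℂ)) p :=
  hl.toSchwartz.memLp p volume

/-- A test function as an element of `L²(0, c)`. -/
def toL2 (hl : IsTest c l) : Lp ℂ 2 (volIoo c) := ((hl.memLp 2).restrict (Set.Ioo 0 c)).toLp _

theorem coeFn_toL2 (hl : IsTest c l) :
    (hl.toL2 : ℝ → ℂ) =ᵐ[volIoo c] fun t => (l t : ℂ) := MemLp.coeFn_toLp _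

theorem coeFn_extendZero_toL2 (hl : IsTest c l) :
    (extendZero c hl.toL2 : ℝ → ℂ) =ᵐ[volume] fun t => (l t : ℂ) := by
  filter_upwards [coeFn_extendZero c hl.toL2,
    (ae_restrict_iff' measurableSet_Ioo).1 hl.coeFn_toL2] with t h1 h2
  rw [h1]
  by_cases ht : t ∈ Set.Ioo 0 c
  · rw [Set.indicator_of_mem ht, h2 ht]
  · rw [Set.indicator_of_notMem ht, hl.eq_zero ht, Complex.ofReal_zero]

theorem coeFn_fourierEquiv_symm (hl : IsTest c l) :
    (fourierEquiv.symm (extendZero c hl.toL2) : ℝ → ℂ) =ᵐ[volume]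
      invFourier fun t => (l t : ℂ) := by
  rw [← invFourier_congr_ae hl.coeFn_extendZero_toL2]
  exact WienerHopf.coeFn_fourierEquiv_symm _ (hl.integrable.congr hl.coeFn_extendZero_toL2.symm)

theorem setIntegral_mul (hl : IsTest c l) (f : ℝ → ℂ) :
    ∫ t in Set.Ioo 0 c, (l t : ℂ) * f t = ∫ t, (l t : ℂ) * f t :=
  setIntegral_eq_integral_of_forall_compl_eq_zero fun t ht => by simp [hl.eq_zero ht]

theorem fourier_toSchwartz (hl : IsTest c l) (x : ℝ) :
    invFourier (fun t => (l t : ℂ)) x =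
      ((Real.sqrt (2 * Real.pi) : ℝ) : ℂ)⁻¹ * 𝓕 hl.toSchwartz (-(x / (2 * Real.pi))) := by
  rw [invFourier, SchwartzMap.fourier_coe, Real.fourier_eq']
  congr 1
  refine integral_congr_ae (.of_forall fun t => ?_)
  simp only [RCLike.inner_apply, conj_trivial, smul_eq_mul, toSchwartz_apply]
  congr 2
  have : -2 * Real.pi * (-(x / (2 * Real.pi)) * t) = x * t := by
    have := Real.pi_pos.ne'
    field_simp
  rw [this]
  push_cast
  ring

theorem continuous_invFourier (hl : IsTest c l) :
    Continuous (invFourier fun t => (l t : ℂ)) := by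
  have h : invFourier (fun t => (l t : ℂ)) = fun x => ((Real.sqrt (2 * Real.pi) : ℝ) : ℂ)⁻¹ *
      𝓕 hl.toSchwartz (-(x / (2 * Real.pi))) := funext hl.fourier_toSchwartz
  rw [h]
  have := (𝓕 hl.toSchwartz).continuous
  fun_prop

/-- This serves twice: it makes the preimage under `V` bounded on the circle, and it turns `H / (x +
i) ∈ L²` into `conj H · ľ ∈ L²`. -/
theorem exists_bound_invFourier (hl : IsTest c l) :
    ∃ C, ∀ x : ℝ, ‖((x : ℂ) + Complex.I) * invFourier (fun t => (l t : ℂ)) x‖ ≤ C := by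
  obtain ⟨C₀, h₀, hC₀⟩ := (𝓕 hl.toSchwartz).decay 0 0
  obtain ⟨C₁, h₁, hC₁⟩ := (𝓕 hl.toSchwartz).decay 1 0
  refine ⟨‖((Real.sqrt (2 * Real.pi) : ℝ) : ℂ)⁻¹‖ * (2 * Real.pi * C₁ + C₀), fun x => ?_⟩
  have h2 := hC₀ (-(x / (2 * Real.pi)))
  have h3 := hC₁ (-(x / (2 * Real.pi)))
  simp only [pow_zero, one_mul, norm_iteratedFDeriv_zero, pow_one, norm_neg, norm_div] at h2 h3
  rw [Real.norm_of_nonneg Real.two_pi_pos.le, div_mul_eq_mul_div,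
    div_le_iff₀ Real.two_pi_pos] at h3
  rw [hl.fourier_toSchwartz, mul_left_comm, norm_mul]
  gcongr
  rw [norm_mul]
  calc _ ≤ (‖x‖ + 1) * ‖𝓕 hl.toSchwartz (-(x / (2 * Real.pi)))‖ := by
        gcongr
        refine (norm_add_le _ _).trans ?_
        simp
    _ ≤ _ := by linarith

theorem integrable_mul {μ : Measure ℝ} (hl : IsTest c l) {f : ℝ → ℂ} (hf : Integrable f μ) :
    Integrable (fun t => (l t : ℂ) * f t) μ := by
  obtain ⟨C, hC⟩ := hl.contDiff.continuous.bounded_above_of_compact_support hl.hasCompactSupport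
  refine hf.bdd_mul (c := C) (by have := hl.contDiff.continuous; fun_prop)
    (.of_forall fun t => ?_)
  rw [Complex.norm_real]
  exact hC t

end IsTest

theorem ae_eq_of_integral_isTest {c : ℝ} {f g : ℝ → ℂ} (hf : Integrable f (volIoo c))
    (hg : Integrable g (volIoo c))
    (h : ∀ l, IsTest c l →
      ∫ t in Set.Ioo 0 c, (l t : ℂ) * f t = ∫ t in Set.Ioo 0 c, (l t : ℂ) * g t) :
    f =ᵐ[volIoo c] g := by
  have h1 : ∀ᵐ t, t ∈ Set.Ioo 0 c → (f - g) t = 0 := by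
    refine isOpen_Ioo.ae_eq_zero_of_integral_contDiff_smul_eq_zero
      (IntegrableOn.locallyIntegrableOn (hf.sub hg)) fun l h1 h2 h3 => ?_
    have hl : IsTest c l := ⟨h1, h2, h3⟩
    have h4 := h l hl
    rw [← sub_eq_zero, ← integral_sub (hl.integrable_mul hf) (hl.integrable_mul hg)] at h4
    rw [← h4, ← setIntegral_eq_integral_of_forall_compl_eq_zero (s := Set.Ioo 0 c)
      (fun t ht => by simp [hl.eq_zero ht])]
    refine integral_congr_ae (.of_forall fun t => ?_)
    simp [mul_sub]
  refine (ae_restrict_iff' measurableSet_Ioo).2 ?_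
  filter_upwards [h1] with t ht hm
  exact sub_eq_zero.1 (ht hm)

/-! ### Symbols -/

section Symbol

variable {h g : ℝ → ℂ} {c d : ℝ} {k l : ℝ → ℝ}

/-- The reflected translate `t ↦ k (x - t)` of a test function. -/
def IsTest.reflect (hk : IsTest c k) (x : ℝ) : 𝓢(ℝ, ℂ) :=
  HasCompactSupport.toSchwartzMap (f := fun t => ((k (x - t) : ℝ) : ℂ))
    ((hk.hasCompactSupport.comp_left (g := Complex.ofReal) rfl).comp_homeomorph
      (Homeomorph.subLeft x))
    (Complex.ofRealCLM.contDiff.comp (hk.contDiff.comp (contDiff_const.sub contDiff_id)))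

theorem IsTest.fourier_reflect (hk : IsTest c k) (x y : ℝ) :
    ((2 * Real.pi : ℝ) : ℂ)⁻¹ * 𝓕 (hk.reflect x : ℝ → ℂ) (y / (2 * Real.pi)) =
      ((Real.sqrt (2 * Real.pi) : ℝ) : ℂ)⁻¹ * Complex.exp (-(Complex.I * y * x)) *
        invFourier (fun t => (k t : ℂ)) y := by
  have h0 := Real.two_pi_pos
  have h1 : (((2 * Real.pi : ℝ)) : ℂ)⁻¹ = ((Real.sqrt (2 * Real.pi) : ℝ) : ℂ)⁻¹ *
      ((Real.sqrt (2 * Real.pi) : ℝ) : ℂ)⁻¹ := by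
    rw [← mul_inv, ← Complex.ofReal_mul, Real.mul_self_sqrt h0.le]
  rw [invFourier, h1, mul_assoc, mul_assoc, mul_left_comm (Complex.exp _)]
  congr 2
  rw [Real.fourier_eq', ← integral_const_mul, ← integral_sub_left_eq_self _ _ x]
  refine integral_congr_ae (.of_forall fun t => ?_)
  simp only [RCLike.inner_apply, conj_trivial, smul_eq_mul]
  have h2 : hk.reflect x (x - t) = (k t : ℂ) := by
    change ((k (x - (x - t)) : ℝ) : ℂ) = _
    rw [sub_sub_cancel]
  have h3 : -2 * Real.pi * (y / (2 * Real.pi) * (x - t)) = -(y * x) + y * t := by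
    field_simp
    ring
  rw [h2, h3, ← mul_assoc, ← Complex.exp_add]
  congr 2
  push_cast
  ring

theorem IsSymbolTransform.integrable_mul_invFourier (hgh : IsSymbolTransform h g)
    (hk : IsTest c k) : Integrable fun y => h y * invFourier (fun t => (k t : ℂ)) y := by
  have h1 := (hgh (hk.reflect 0)).2.1
  simp only [hk.fourier_reflect] at h1
  refine (h1.const_mul ((Real.sqrt (2 * Real.pi) : ℝ) : ℂ)).congr (.of_forall fun y => ?_)
  simp only [Complex.ofReal_zero, mul_zero, neg_zero, Complex.exp_zero, mul_one]
  rw [mul_left_comm, mul_inv_cancel_left₀ sqrt_two_pi_ne_zero]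

/-- The convolution at `x` is the pairing of `g` with the reflected translate of `k`, whose
transform carries the phase `exp (-i y x)`. -/
theorem IsSymbolTransform.integral_conv (hgh : IsSymbolTransform h g) (hk : IsTest c k) (x : ℝ) :
    ∫ t, g (x - t) * k t = ∫ y : ℝ, ((Real.sqrt (2 * Real.pi) : ℝ) : ℂ)⁻¹ *
      Complex.exp (-(Complex.I * y * x)) * (h y * invFourier (fun t => (k t : ℂ)) y) := by
  have h1 := (hgh (hk.reflect x)).2.2
  simp only [hk.fourier_reflect] at h1
  rw [← integral_sub_left_eq_self _ _ x] at h1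
  have h2 : ∀ t, hk.reflect x (x - t) = (k t : ℂ) := fun t => by
    change ((k (x - (x - t)) : ℝ) : ℂ) = _
    rw [sub_sub_cancel]
  simp only [h2] at h1
  rw [h1]
  simp only [mul_left_comm]

theorem conj_invFourier (l : ℝ → ℝ) (y : ℝ) :
    conj (invFourier (fun t => (l t : ℂ)) y) = ((Real.sqrt (2 * Real.pi) : ℝ) : ℂ)⁻¹ *
      ∫ x : ℝ, Complex.exp (-(Complex.I * y * x)) * l x := by
  rw [invFourier, map_mul, map_inv₀, Complex.conj_ofReal, ← integral_conj]
  congr 1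
  refine integral_congr_ae (.of_forall fun t => ?_)
  simp [← Complex.exp_conj]

/-- The bilinear form of a convolution operator, expressed by its symbol. -/
theorem IsSymbolTransform.integral_mul_conv (hgh : IsSymbolTransform h g) (hl : IsTest d l)
    (hk : IsTest c k) :
    ∫ x, (l x : ℂ) * ∫ t, g (x - t) * k t =
      ∫ y, conj (invFourier (fun t => (l t : ℂ)) y) *
        (h y * invFourier (fun t => (k t : ℂ)) y) := by
  have hi := hgh.integrable_mul_invFourier hk
  simp only [hgh.integral_conv hk, conj_invFourier, ← integral_const_mul, ← integral_mul_const]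
  rw [integral_integral_swap]
  · refine integral_congr_ae (.of_forall fun y => integral_congr_ae (.of_forall fun x => ?_))
    simp only
    ring
  · have h1 : Integrable (fun p : ℝ × ℝ => ((Real.sqrt (2 * Real.pi) : ℝ) : ℂ)⁻¹ *
        Complex.exp (-(Complex.I * p.2 * p.1)) *
          ((l p.1 : ℂ) * (h p.2 * invFourier (fun t => (k t : ℂ)) p.2)))
        (volume.prod volume) := by
      refine (hl.integrable.mul_prod hi).bdd_mul
        (c := ‖((Real.sqrt (2 * Real.pi) : ℝ) : ℂ)⁻¹‖) (by fun_prop) (.of_forall fun p => ?_)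
      rw [norm_mul, show -(Complex.I * (p.2 : ℂ) * p.1) = ((-(p.2 * p.1) : ℝ) : ℂ) * Complex.I by
        push_cast; ring, Complex.norm_exp_ofReal_mul_I, mul_one]
    refine h1.congr (.of_forall fun p => ?_)
    simp only [Function.uncurry]
    ring

/-- A bump function equal to `1` on the interval is a Schwartz function against which `g` is
integrable. -/
theorem IsSymbolTransform.integrableOn_Icc (hgh : IsSymbolTransform h g) (R : ℝ) (hR : 0 < R) :
    IntegrableOn g (Set.Icc (-R) R) := by
  let φ : ContDiffBump (0 : ℝ) := ⟨R, R + 1, hR, by linarith⟩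
  have h1 := (hgh (HasCompactSupport.toSchwartzMap (f := fun t => ((φ t : ℝ) : ℂ))
    (φ.hasCompactSupport.comp_left (g := Complex.ofReal) rfl)
    (Complex.ofRealCLM.contDiff.comp φ.contDiff))).1
  refine h1.integrableOn.congr_fun (fun t ht => ?_) measurableSet_Icc
  have h2 : φ t = 1 := φ.one_of_mem_closedBall (by
    rw [Metric.mem_closedBall, dist_zero_right, Real.norm_eq_abs]
    exact abs_le.2 ht)
  change g t * ((φ t : ℝ) : ℂ) = g t
  rw [h2, Complex.ofReal_one, mul_one]

theorem IsSymbolTransform.integrable_kernel (hgh : IsSymbolTransform h g) {f : ℝ → ℂ}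
    (hf : Integrable f (volIoo c)) :
    Integrable (fun p : ℝ × ℝ => g (p.1 - p.2) * f p.2) ((volIoo d).prod (volIoo c)) := by
  -- For `x ∈ (0, d)` and `t ∈ (0, c)` the difference `x - t` stays in `[-R, R]`. Hence `g` may be
  -- cut off to an integrable function, and the convolution of integrable functions applies.
  set R := |c| + |d| + 1 with hRdef
  have hR : 0 < R := by positivity
  have h1 : Integrable ((Set.Icc (-R) R).indicator g) :=
    (integrable_indicator_iff measurableSet_Icc).2 (hgh.integrableOn_Icc R hR)
  have h2 := (hf.convolution_integrand (ContinuousLinearMap.mul ℂ ℂ) h1).restrict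
    (s := Set.Ioo 0 d ×ˢ Set.univ)
  rw [← Measure.prod_restrict, Measure.restrict_univ] at h2
  refine h2.congr ?_
  rw [Measure.prod_restrict, Filter.EventuallyEq,
    ae_restrict_iff' (measurableSet_Ioo.prod measurableSet_Ioo)]
  refine .of_forall fun p hp => ?_
  obtain ⟨⟨h3, h4⟩, h5, h6⟩ := hp
  have h7 : p.1 - p.2 ∈ Set.Icc (-R) R := by
    constructor <;> linarith [le_abs_self c, le_abs_self d, abs_nonneg c, abs_nonneg d]
  simp only [ContinuousLinearMap.mul_apply']
  rw [Set.indicator_of_mem h7, mul_comm]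

theorem IsSymbolTransform.integrable_setIntegral (hgh : IsSymbolTransform h g) {f : ℝ → ℂ}
    (hf : Integrable f (volIoo c)) (d : ℝ) :
    Integrable (fun x => ∫ t in Set.Ioo 0 c, g (x - t) * f t) (volIoo d) :=
  (hgh.integrable_kernel hf).integral_prod_left

theorem IsSymbolTransform.integrable_test_kernel (hgh : IsSymbolTransform h g) (hl : IsTest d l)
    {f : ℝ → ℂ} (hf : Integrable f (volIoo c)) :
    Integrable (fun p : ℝ × ℝ => (l p.1 : ℂ) * (g (p.1 - p.2) * f p.2))
      ((volIoo d).prod (volIoo c)) := by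
  obtain ⟨C, hC⟩ := hl.contDiff.continuous.bounded_above_of_compact_support hl.hasCompactSupport
  refine (hgh.integrable_kernel hf).bdd_mul (c := C)
    (by have := hl.contDiff.continuous; fun_prop) (.of_forall fun t => ?_)
  rw [Complex.norm_real]
  exact hC _

theorem IsSymbolTransform.integral_swap (hgh : IsSymbolTransform h g) (hl : IsTest d l)
    {f : ℝ → ℂ} (hf : Integrable f (volIoo c)) :
    ∫ x in Set.Ioo 0 d, (l x : ℂ) * ∫ t in Set.Ioo 0 c, g (x - t) * f t =
      ∫ t in Set.Ioo 0 c, f t * ∫ x in Set.Ioo 0 d, l x * g (x - t) := by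
  simp only [← integral_const_mul]
  rw [integral_integral_swap (hgh.integrable_test_kernel hl hf)]
  refine integral_congr_ae (.of_forall fun t => integral_congr_ae (.of_forall fun x => ?_))
  simp only
  ring

theorem IsSymbolTransform.integrable_transpose (hgh : IsSymbolTransform h g) (hl : IsTest d l) :
    Integrable (fun t => ∫ x in Set.Ioo 0 d, l x * g (x - t)) (volIoo c) := by
  have h1 := (hgh.integrable_test_kernel hl (integrable_const (1 : ℂ) (μ := volIoo c)))
  simpa using h1.integral_prod_right

end Symbol

/-! ### Operators and their bilinear forms on test functions -/

section Forms

variable {a b : ℝ} {G H : ℝ → Matrix (Fin 2) (Fin 2) ℂ}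

theorem inner_toL2_eq_integral {c : ℝ} {l : ℝ → ℝ} (hl : IsTest c l)
    (f : Lp ℂ 2 (volIoo c)) :
    inner ℂ hl.toL2 f = ∫ t in Set.Ioo 0 c, (l t : ℂ) * f t := by
  rw [L2.inner_def]
  refine integral_congr_ae ?_
  filter_upwards [hl.coeFn_toL2] with t ht
  rw [ht, RCLike.inner_apply, mul_comm, Complex.conj_ofReal]

theorem inner_single_left (i : Fin 2) (l : Lp ℂ 2 (volIoo ((![a, b] : Fin 2 → ℝ) i)))
    (k : L2Intervals a b) : inner ℂ (PiLp.single 2 i l : L2Intervals a b) k = inner ℂ l (k i) := by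
  rw [PiLp.inner_apply, Finset.sum_eq_single i]
  · simp
  · intro j _ hj
    rw [PiLp.single_eq_of_ne 2 hj, inner_zero_left]
  · simp

theorem integrable_coeFn_volIoo {c : ℝ} (f : Lp ℂ 2 (volIoo c)) :
    Integrable (f : ℝ → ℂ) (volIoo c) :=
  (Lp.memLp f).integrable (by norm_num)

theorem eq_of_inner_toL2 {c : ℝ} {f g : Lp ℂ 2 (volIoo c)}
    (h : ∀ l (hl : IsTest c l), inner ℂ hl.toL2 f = inner ℂ hl.toL2 g) : f = g := by
  refine Lp.ext (ae_eq_of_integral_isTest (integrable_coeFn_volIoo f)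
    (integrable_coeFn_volIoo g) fun l hl => ?_)
  rw [← inner_toL2_eq_integral hl, ← inner_toL2_eq_integral hl, h l hl]

/-- The bilinear form of `W` on test functions is given by the symbol `H`. -/
def HasSymbolForm (a b : ℝ) (H : ℝ → Matrix (Fin 2) (Fin 2) ℂ)
    (W : L2Intervals a b →L[ℂ] L2Intervals a b) : Prop :=
  ∀ (i j : Fin 2) (l k : ℝ → ℝ) (hl : IsTest ((![a, b] : Fin 2 → ℝ) i) l)
    (hk : IsTest ((![a, b] : Fin 2 → ℝ) j) k),
    inner ℂ hl.toL2 (W (PiLp.single 2 j hk.toL2) i) =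
      ∫ y, conj (invFourier (fun t => (l t : ℂ)) y) *
        (H y i j * invFourier (fun t => (k t : ℂ)) y)

theorem HasSymbolForm.unique {W W' : L2Intervals a b →L[ℂ] L2Intervals a b}
    (hW : HasSymbolForm a b H W) (hW' : HasSymbolForm a b H W') : W = W' := by
  have h1 : ∀ (j : Fin 2) (k : ℝ → ℝ) (hk : IsTest ((![a, b] : Fin 2 → ℝ) j) k),
      W (PiLp.single 2 j hk.toL2) = W' (PiLp.single 2 j hk.toL2) := fun j k hk => by
    ext1 i
    exact eq_of_inner_toL2 fun l hl => by rw [hW i j l k hl hk, hW' i j l k hl hk]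
  -- Agreement on test columns passes to all columns by duality: the adjoints agree when paired with
  -- test functions, which separate points.
  have h2 : W.adjoint = W'.adjoint := by
    ext1 f
    ext1 j
    refine eq_of_inner_toL2 fun k hk => ?_
    rw [← inner_single_left, ← inner_single_left, ContinuousLinearMap.adjoint_inner_right,
      ContinuousLinearMap.adjoint_inner_right, h1]
  exact ContinuousLinearMap.adjoint.injective h2

theorem memLp_top_single {j : Fin 2} {k : ℝ → ℝ} (hk : IsTest ((![a, b] : Fin 2 → ℝ) j) k)
    (j' : Fin 2) :
    MemLp ((PiLp.single 2 j hk.toL2 : L2Intervals a b) j' : ℝ → ℂ) ⊤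
      (volIoo ((![a, b] : Fin 2 → ℝ) j')) := by
  by_cases hj : j' = j
  · subst hj
    rw [PiLp.single_eq_same]
    exact ((hk.memLp ⊤).restrict _).ae_eq hk.coeFn_toL2.symm
  · rw [PiLp.single_eq_of_ne 2 hj]
    exact (MemLp.zero (ε := ℂ)).ae_eq (Lp.coeFn_zero ℂ 2 _).symm

theorem wienerHopfFun_single {j : Fin 2} {k : ℝ → ℝ} (hk : IsTest ((![a, b] : Fin 2 → ℝ) j) k)
    (i : Fin 2) (x : ℝ) :
    wienerHopfFun a b G (fun j' => ((PiLp.single 2 j hk.toL2 : L2Intervals a b) j' : ℝ → ℂ)) i x =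
      ∫ t, G (x - t) i j * k t := by
  rw [wienerHopfFun, Finset.sum_eq_single j]
  · have h : ∫ t in Set.Ioo 0 ((![a, b] : Fin 2 → ℝ) j), G (x - t) i j * k t =
        ∫ t, G (x - t) i j * k t :=
      setIntegral_eq_integral_of_forall_compl_eq_zero fun t ht => by simp [hk.eq_zero ht]
    rw [← h]
    refine integral_congr_ae ?_
    filter_upwards [hk.coeFn_toL2] with t ht
    rw [PiLp.single_eq_same, ht]
  · intro j' _ hj
    refine integral_eq_zero_of_ae ?_
    rw [PiLp.single_eq_of_ne 2 hj]
    filter_upwards [Lp.coeFn_zero ℂ 2 (volIoo ((![a, b] : Fin 2 → ℝ) j'))] with t ht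
    rw [ht, Pi.zero_apply, mul_zero]
  · simp

theorem IsWienerHopf.hasSymbolForm
    (hGH : ∀ i j, IsSymbolTransform (fun x => H x i j) (fun t => G t i j))
    {W : L2Intervals a b →L[ℂ] L2Intervals a b} (hW : IsWienerHopf a b G W) :
    HasSymbolForm a b H W := by
  intro i j l k hl hk
  rw [← (hGH i j).integral_mul_conv hl hk, inner_toL2_eq_integral, ← hl.setIntegral_mul]
  refine integral_congr_ae ?_
  filter_upwards [hW _ (memLp_top_single hk) i] with x hx
  rw [hx, wienerHopfFun_single]

theorem adjoint_single_apply {W : L2Intervals a b →L[ℂ] L2Intervals a b}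
    (hW : HasSymbolForm a b H W) {i : Fin 2} {l : ℝ → ℝ}
    (hl : IsTest ((![a, b] : Fin 2 → ℝ) i) l) (j : Fin 2) {k : ℝ → ℝ}
    (hk : IsTest ((![a, b] : Fin 2 → ℝ) j) k) :
    inner ℂ (W.adjoint (PiLp.single 2 i hl.toL2) j) hk.toL2 =
      ∫ y, conj (invFourier (fun t => (l t : ℂ)) y) *
        (H y i j * invFourier (fun t => (k t : ℂ)) y) := by
  rw [← inner_conj_symm, ← inner_single_left, inner_conj_symm,
    ContinuousLinearMap.adjoint_inner_left, inner_single_left, hW i j l k hl hk]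

theorem inner_single_map (W : L2Intervals a b →L[ℂ] L2Intervals a b) (i : Fin 2)
    (l : Lp ℂ 2 (volIoo ((![a, b] : Fin 2 → ℝ) i))) (k : L2Intervals a b) :
    inner ℂ l (W k i) = ∑ j, inner ℂ (W.adjoint (PiLp.single 2 i l) j) (k j) := by
  rw [← inner_single_left, ← ContinuousLinearMap.adjoint_inner_left, PiLp.inner_apply]

/-- The form knows `W` on test columns only. With one test function moved to the adjoint, the other
factor becomes an explicit function that can be paired with any element of `L²`. -/
theorem HasSymbolForm.conj_adjoint_ae_eq
    (hGH : ∀ i j, IsSymbolTransform (fun x => H x i j) (fun t => G t i j))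
    {W : L2Intervals a b →L[ℂ] L2Intervals a b} (hW : HasSymbolForm a b H W) {i : Fin 2}
    {l : ℝ → ℝ} (hl : IsTest ((![a, b] : Fin 2 → ℝ) i) l) (j : Fin 2) :
    (fun t => conj (W.adjoint (PiLp.single 2 i hl.toL2) j t))
      =ᵐ[volIoo ((![a, b] : Fin 2 → ℝ) j)]
        fun t => ∫ x in Set.Ioo 0 ((![a, b] : Fin 2 → ℝ) i), l x * G (x - t) i j := by
  refine ae_eq_of_integral_isTest
    ((LinearIsometryEquiv.integrable_comp_iff Complex.conjLIE).2 (integrable_coeFn_volIoo _))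
    ((hGH i j).integrable_transpose hl) fun k hk => ?_
  have h1 := adjoint_single_apply hW hl j hk
  rw [← (hGH i j).integral_mul_conv hl hk, L2.inner_def, ← hl.setIntegral_mul] at h1
  have hki : Integrable (fun t => (k t : ℂ)) (volIoo ((![a, b] : Fin 2 → ℝ) j)) :=
    hk.integrable.restrict
  rw [← (hGH i j).integral_swap hl hki]
  refine Eq.trans ?_ (h1.trans ?_)
  · refine integral_congr_ae ?_
    filter_upwards [hk.coeFn_toL2] with t ht
    rw [RCLike.inner_apply, ht]
  · refine integral_congr_ae (.of_forall fun x => ?_)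
    simp only
    rw [setIntegral_eq_integral_of_forall_compl_eq_zero fun t ht => by simp [hk.eq_zero ht]]

/-- Pairing with `l` moves `W` to the explicit adjoint, and Fubini moves the kernel back. No
approximation of `k` is involved, since `L²` of a bounded interval lies in `L¹`. -/
theorem HasSymbolForm.isWienerHopf
    (hGH : ∀ i j, IsSymbolTransform (fun x => H x i j) (fun t => G t i j))
    {W : L2Intervals a b →L[ℂ] L2Intervals a b} (hW : HasSymbolForm a b H W) :
    IsWienerHopf a b G W := by
  intro k _ i
  have hk : ∀ j, Integrable (k j : ℝ → ℂ) (volIoo ((![a, b] : Fin 2 → ℝ) j)) :=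
    fun j => integrable_coeFn_volIoo (k j)
  refine ae_eq_of_integral_isTest (integrable_coeFn_volIoo _)
    (integrable_finsetSum _ fun j _ => (hGH i j).integrable_setIntegral (hk j) _)
    fun l hl => ?_
  rw [← inner_toL2_eq_integral hl, inner_single_map]
  simp only [wienerHopfFun, Finset.mul_sum]
  rw [integral_finsetSum _ fun j _ =>
    hl.integrable_mul ((hGH i j).integrable_setIntegral (hk j) _)]
  refine Finset.sum_congr rfl fun j _ => ?_
  rw [(hGH i j).integral_swap hl (hk j), L2.inner_def]
  refine integral_congr_ae ?_
  filter_upwards [hW.conj_adjoint_ae_eq hGH hl j] with t ht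
  rw [RCLike.inner_apply, ht]

/-! ### Truncated Toeplitz operators -/

/-- The operator on the space of columns on the intervals that is unitarily equivalent to a given
operator on the model space. -/
def conjModel (A : modelSpace (diagInnerDisc a b) →L[ℂ] modelSpace (diagInnerDisc a b)) :
    L2Intervals a b →L[ℂ] L2Intervals a b :=
  ((modelEquiv a b).toContinuousLinearEquiv : _ →L[ℂ] L2Intervals a b) ∘L A ∘L
    ((modelEquiv a b).symm.toContinuousLinearEquiv : L2Intervals a b →L[ℂ] _)

theorem conjModel_apply (A : modelSpace (diagInnerDisc a b) →L[ℂ] modelSpace (diagInnerDisc a b))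
    (k : L2Intervals a b) :
    conjModel A k = modelEquiv a b (A ((modelEquiv a b).symm k)) := rfl

/-- The operator on the model space that is unitarily equivalent to a given operator on the space
of columns on the intervals. -/
def conjIntervals (W : L2Intervals a b →L[ℂ] L2Intervals a b) :
    modelSpace (diagInnerDisc a b) →L[ℂ] modelSpace (diagInnerDisc a b) :=
  ((modelEquiv a b).symm.toContinuousLinearEquiv : L2Intervals a b →L[ℂ] _) ∘L W ∘L
    ((modelEquiv a b).toContinuousLinearEquiv : _ →L[ℂ] L2Intervals a b)

theorem conjIntervals_apply (W : L2Intervals a b →L[ℂ] L2Intervals a b)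
    (f : modelSpace (diagInnerDisc a b)) :
    conjIntervals W f = (modelEquiv a b).symm (W (modelEquiv a b f)) := rfl

theorem intervalsToCircle_single_ne {i j : Fin 2} (hij : i ≠ j)
    (l : Lp ℂ 2 (volIoo ((![a, b] : Fin 2 → ℝ) j))) :
    intervalsToCircle a b (PiLp.single 2 j l) i = 0 := by
  rw [intervalsToCircle_apply, PiLp.single_eq_of_ne 2 hij, map_zero, map_zero]

theorem halfPlaneEquiv_intervalsToCircle (k : L2Intervals a b) (i : Fin 2) :
    halfPlaneEquiv (intervalsToCircle a b k i) =
      fourierEquiv.symm (extendZero ((![a, b] : Fin 2 → ℝ) i) (k i)) := by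
  rw [intervalsToCircle_apply]
  exact halfPlaneEquiv.apply_symm_apply _

theorem inner_intervalsToCircle_single {i : Fin 2} {l : ℝ → ℝ}
    (hl : IsTest ((![a, b] : Fin 2 → ℝ) i) l) (u : L2T2) :
    inner ℂ (intervalsToCircle a b (PiLp.single 2 i hl.toL2)) u =
      ∫ y, conj (invFourier (fun t => (l t : ℂ)) y) * halfPlaneEquiv (u i) y := by
  rw [PiLp.inner_apply, Finset.sum_eq_single i]
  · rw [← halfPlaneEquiv.inner_map_map, halfPlaneEquiv_intervalsToCircle, L2.inner_def]
    refine integral_congr_ae ?_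
    rw [PiLp.single_eq_same]
    filter_upwards [hl.coeFn_fourierEquiv_symm] with y hy
    rw [hy, RCLike.inner_apply, mul_comm]
  · intro j _ hj
    rw [intervalsToCircle_single_ne hj, inner_zero_left]
  · simp

theorem halfPlaneEquiv_intervalsToCircle_single {j : Fin 2} {k : ℝ → ℝ}
    (hk : IsTest ((![a, b] : Fin 2 → ℝ) j) k) :
    (halfPlaneEquiv (intervalsToCircle a b (PiLp.single 2 j hk.toL2) j) : ℝ → ℂ) =ᵐ[volume]
      invFourier fun t => (k t : ℂ) := by
  rw [halfPlaneEquiv_intervalsToCircle]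
  simpa only [PiLp.single_eq_same] using hk.coeFn_fourierEquiv_symm

theorem memLp_top_intervalsToCircle_single {j : Fin 2} {k : ℝ → ℝ}
    (hk : IsTest ((![a, b] : Fin 2 → ℝ) j) k) (i : Fin 2) :
    MemLp (intervalsToCircle a b (PiLp.single 2 j hk.toL2) i : T → ℂ) ⊤
      (AddCircle.haarAddCircle : Measure T) := by
  by_cases hij : i = j
  · subst hij
    obtain ⟨C, hC⟩ := hk.exists_bound_invFourier
    refine memLp_top_of_bound (Lp.aestronglyMeasurable _) (Real.sqrt Real.pi * C) ?_
    refine ae_of_ae_cayleyBdryInv ?_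
    filter_upwards [halfPlaneEquiv_intervalsToCircle_single hk, coeFn_halfPlaneEquiv
      (intervalsToCircle a b (PiLp.single 2 i hk.toL2) i)] with x h1 h2
    -- Undoing the weight, the function on the circle is `√π (x + i) ǩ(x)` at `m⁻¹ x`.
    rw [h1, halfPlane, eq_inv_mul_iff_mul_eq₀ (fun h => halfPlane_weight_ne_zero x (by rw [h, inv_zero])),
      mul_assoc] at h2
    rw [← h2, norm_mul, Complex.norm_real, Real.norm_of_nonneg (Real.sqrt_nonneg _)]
    gcongr
    exact hC x
  · rw [intervalsToCircle_single_ne hij]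
    exact (MemLp.zero (ε := ℂ)).ae_eq (Lp.coeFn_zero ℂ 2 _).symm

theorem halfPlaneEquiv_mul_ae_eq {u : L2T2} {f : L2T2} {i : Fin 2}
    (hu : (u i : T → ℂ) =ᵐ[AddCircle.haarAddCircle]
      fun z => ∑ j, H (cayleyBdry z) i j * (f j : T → ℂ) z) :
    (halfPlaneEquiv (u i) : ℝ → ℂ) =ᵐ[volume]
      fun x => ∑ j, H x i j * halfPlaneEquiv (f j) x := by
  filter_upwards [coeFn_halfPlaneEquiv (u i), ae_cayleyBdryInv hu,
    ae_all_iff.2 fun j => coeFn_halfPlaneEquiv (f j)] with x h1 h2 h3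
  rw [h1, halfPlane, h2, Finset.mul_sum]
  refine Finset.sum_congr rfl fun j _ => ?_
  rw [h3 j, halfPlane, cayleyBdry_cayleyBdryInv, mul_left_comm]

/-- The error `u - A f` is orthogonal to the model space, so paired with the image of `l` the
operator may be replaced by plain multiplication by the symbol. -/
theorem IsMTTO.hasSymbolForm
    {A : modelSpace (diagInnerDisc a b) →L[ℂ] modelSpace (diagInnerDisc a b)}
    (hA : IsMTTO (diagInnerDisc a b) (fun z => H (cayleyBdry z)) A) :
    HasSymbolForm a b H (conjModel A) := by
  intro i j l k hl hk
  obtain ⟨u, hu, hperp⟩ := hA.2 ((modelEquiv a b).symm (PiLp.single 2 j hk.toL2))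
    (memLp_top_intervalsToCircle_single hk)
  rw [conjModel_apply, ← inner_single_left,
    ← (modelEquiv a b).symm.inner_map_map, LinearIsometryEquiv.symm_apply_apply,
    Submodule.coe_inner]
  have h1 := (Submodule.mem_orthogonal _ _).1 hperp _
    ((modelEquiv a b).symm (PiLp.single 2 i hl.toL2)).2
  rw [inner_sub_right, sub_eq_zero] at h1
  rw [← h1, coe_modelEquiv_symm, inner_intervalsToCircle_single]
  refine integral_congr_ae ?_
  filter_upwards [halfPlaneEquiv_mul_ae_eq (hu i), halfPlaneEquiv_intervalsToCircle_single hk,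
    Lp.coeFn_zero ℂ 2 (volume : Measure ℝ)] with x h2 h3 h4
  rw [h2, Finset.sum_eq_single j]
  · rw [← h3, coe_modelEquiv_symm]
  · intro j' _ hj
    rw [coe_modelEquiv_symm, intervalsToCircle_single_ne hj, map_zero, h4]
    simp
  · simp

end Forms

/-! ### Integrability of the symbol -/

theorem memLp_comp_cayleyBdry {h : ℝ → ℂ}
    (hh : MemLp (fun x : ℝ => ((x : ℂ) + Complex.I)⁻¹ * h x) 2 volume) :
    MemLp (fun z => h (cayleyBdry z)) 2 (AddCircle.haarAddCircle : Measure T) := by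
  have hw : MemLp (fun x : ℝ => ((Real.sqrt Real.pi : ℂ) * ((x : ℂ) + Complex.I))⁻¹ * h x)
      2 volume := by
    refine (hh.const_mul ((Real.sqrt Real.pi : ℂ)⁻¹)).ae_eq (.of_forall fun x => ?_)
    simp only [mul_inv, mul_assoc]
  obtain ⟨f, hfm, hf⟩ := isometricWeight_halfPlane.exists_comp_eq
    measurableEmbedding_cayleyBdryInv halfPlane_weight_ne_zero hw.1
  have hfL : MemLp f 2 (AddCircle.haarAddCircle : Measure T) := by
    refine ⟨hfm, ?_⟩
    rw [← isometricWeight_halfPlane.eLpNorm_eq hfm]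
    simp only [hf]
    exact hw.2
  refine hfL.ae_eq (ae_of_ae_cayleyBdryInv (.of_forall fun x => ?_))
  simp only [cayleyBdry_cayleyBdryInv]
  exact mul_left_cancel₀ (halfPlane_weight_ne_zero x) (hf x)

/-- Keeping the factor `x + ε` on the left makes the identity valid at `x = -ε` too. -/
theorem mul_invFourierInterval_exp {c : ℝ} (hc : 0 < c) (ε x : ℝ) :
    ((x : ℂ) + ε) * invFourierInterval c (fun t => Complex.exp (Complex.I * ε * t)) x =
      ((Real.sqrt (2 * Real.pi) : ℝ) : ℂ)⁻¹ *
        (-Complex.I * (Complex.exp (Complex.I * (x + ε) * c) - 1)) := by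
  rw [invFourierInterval, mul_left_comm]
  congr 1
  have h1 : ∫ t in Set.Ioo 0 c,
      Complex.exp (Complex.I * x * t) * Complex.exp (Complex.I * ε * t) =
        ∫ t in (0 : ℝ)..c, Complex.exp (Complex.I * (x + ε) * t) := by
    rw [intervalIntegral.integral_of_le hc.le, integral_Ioc_eq_integral_Ioo]
    refine integral_congr_ae (.of_forall fun t => ?_)
    simp only
    rw [← Complex.exp_add]
    ring_nf
  rw [h1]
  by_cases h2 : (x : ℂ) + ε = 0
  · simp [h2]
  · rw [integral_exp_mul_complex (mul_ne_zero Complex.I_ne_zero h2)]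
    rw [Complex.ofReal_zero, mul_zero, Complex.exp_zero]
    generalize Complex.exp (Complex.I * (x + ε) * c) = E
    field_simp
    linear_combination (E - 1) * Complex.I_sq

theorem norm_add_div_add_I_le (x ε : ℝ) :
    ‖((x : ℂ) + ε) / ((x : ℂ) + Complex.I)‖ ≤ 1 + |ε| := by
  have h1 : 0 < ‖(x : ℂ) + Complex.I‖ := norm_pos_iff.2 (add_I_ne_zero x)
  have h2 : |x| ≤ ‖(x : ℂ) + Complex.I‖ := by
    simpa using Complex.abs_re_le_norm ((x : ℂ) + Complex.I)
  have h3 : 1 ≤ ‖(x : ℂ) + Complex.I‖ := by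
    simpa using Complex.abs_im_le_norm ((x : ℂ) + Complex.I)
  rw [norm_div, div_le_iff₀ h1, ← Complex.ofReal_add, Complex.norm_real, Real.norm_eq_abs]
  have h4 := abs_add_le x ε
  nlinarith [abs_nonneg ε]

theorem memLp_add_div_add_I_mul {f : ℝ → ℂ} (hf : MemLp f 2 volume) (ε : ℝ) :
    MemLp (fun x : ℝ => ((x : ℂ) + ε) / ((x : ℂ) + Complex.I) * f x) 2 volume := by
  have h1 : Measurable fun x : ℝ => ((x : ℂ) + ε) / ((x : ℂ) + Complex.I) := by fun_prop
  refine hf.of_le_mul (c := 1 + |ε|) (h1.aestronglyMeasurable.mul hf.1) (.of_forall fun x => ?_)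
  rw [norm_mul]
  exact mul_le_mul_of_nonneg_right (norm_add_div_add_I_le x ε) (norm_nonneg _)

/-- A single transform has zeros, coming from `exp (i x c) - 1`. The frequency shift `π / c` changes
the sign of the exponential, so `x J₀ + (x + π / c) J₁` is the constant `2 i / √(2π)`. Dividing by
`x + i` leaves bounded coefficients in front of `H J₀` and `H J₁`. -/
theorem memLp_inv_add_I_mul_of_interval {c : ℝ} (hc : 0 < c) {h : ℝ → ℂ}
    (hh : ∀ ε : ℝ, MemLp (fun x => h x *
      invFourierInterval c (fun t => Complex.exp (Complex.I * ε * t)) x) 2 volume) :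
    MemLp (fun x : ℝ => ((x : ℂ) + Complex.I)⁻¹ * h x) 2 volume := by
  have h1 := (memLp_add_div_add_I_mul (hh 0) 0).add
    (memLp_add_div_add_I_mul (hh (Real.pi / c)) (Real.pi / c))
  -- The factor is the inverse of the constant `2 i / √(2π)`.
  refine (h1.const_mul (((Real.sqrt (2 * Real.pi) : ℝ) : ℂ) * (-Complex.I / 2))).ae_eq
    (.of_forall fun x => ?_)
  have k0 := mul_invFourierInterval_exp hc 0 x
  have k1 := mul_invFourierInterval_exp hc (Real.pi / c) x
  have h2 : Complex.exp (Complex.I * (x + (Real.pi / c : ℝ)) * c) =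
      -Complex.exp (Complex.I * x * c) := by
    have hc' : (c : ℂ) ≠ 0 := by exact_mod_cast hc.ne'
    have : Complex.I * (x + (Real.pi / c : ℝ)) * c =
        Complex.I * x * c + Real.pi * Complex.I := by
      push_cast
      field_simp
    rw [this, Complex.exp_add, Complex.exp_pi_mul_I, mul_neg_one]
  rw [h2] at k1
  rw [Complex.ofReal_zero, add_zero] at k0
  simp only [Pi.add_apply, Complex.ofReal_zero, add_zero, div_eq_mul_inv _ ((x : ℂ) + Complex.I)]
  have hs := sqrt_two_pi_ne_zero
  set s := ((Real.sqrt (2 * Real.pi) : ℝ) : ℂ)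
  set J0 := invFourierInterval c (fun t => Complex.exp (Complex.I * 0 * t)) x
  set J1 := invFourierInterval c
    (fun t => Complex.exp (Complex.I * (Real.pi / c : ℝ) * t)) x
  have h3 : (x : ℂ) * J0 + (x + (Real.pi / c : ℝ)) * J1 = s⁻¹ * (2 * Complex.I) := by
    rw [k0, k1]
    ring
  have h4 : s * (-Complex.I / 2) * (s⁻¹ * (2 * Complex.I)) = 1 := by
    field_simp
    linear_combination (-1) * Complex.I_sq
  rw [← h3] at h4
  linear_combination (((x : ℂ) + Complex.I)⁻¹ * h x) * h4

/-! ### From the hypothesis on `H` and the symbol form to the truncated Toeplitz operator -/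

section Main

variable {a b : ℝ} {G H : ℝ → Matrix (Fin 2) (Fin 2) ℂ}

theorem memLp_inv_add_I_mul_symbol (ha : 0 < a) (hb : 0 < b)
    (hH : ∀ k : Fin 2 → ℝ → ℂ,
      (∀ j, MemLp (k j) ⊤ (volIoo ((![a, b] : Fin 2 → ℝ) j))) →
      ∀ i, MemLp
        (fun x => ∑ j, H x i j * invFourierInterval ((![a, b] : Fin 2 → ℝ) j) (k j) x)
        2 (volume : Measure ℝ)) (i j : Fin 2) :
    MemLp (fun x : ℝ => ((x : ℂ) + Complex.I)⁻¹ * H x i j) 2 volume := by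
  have hc : 0 < (![a, b] : Fin 2 → ℝ) j := by fin_cases j <;> assumption
  refine memLp_inv_add_I_mul_of_interval hc fun ε => ?_
  -- A column with a single nonzero entry isolates `H i j`.
  have h1 := hH (Pi.single j fun t => Complex.exp (Complex.I * ε * t)) (fun j' => ?_) i
  · refine h1.ae_eq (.of_forall fun x => ?_)
    simp only
    rw [Finset.sum_eq_single j]
    · rw [Pi.single_eq_same]
    · intro j' _ hj
      rw [Pi.single_eq_of_ne hj]
      simp [invFourierInterval]
    · simp
  · by_cases hj : j' = j
    · subst hj
      rw [Pi.single_eq_same]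
      refine memLp_top_of_bound (by fun_prop) 1 (.of_forall fun t => ?_)
      rw [show Complex.I * ε * t = ((ε * t : ℝ) : ℂ) * Complex.I by push_cast; ring,
        Complex.norm_exp_ofReal_mul_I]
    · rw [Pi.single_eq_of_ne hj]
      exact MemLp.zero

theorem IsTest.memLp_conj_mul_invFourier {c : ℝ} {l : ℝ → ℝ} (hl : IsTest c l) {h : ℝ → ℂ}
    (hh : MemLp (fun x : ℝ => ((x : ℂ) + Complex.I)⁻¹ * h x) 2 volume) :
    MemLp (fun x => conj (h x) * invFourier (fun t => (l t : ℂ)) x) 2 volume := by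
  obtain ⟨C, hC⟩ := hl.exists_bound_invFourier
  have hm : AEStronglyMeasurable h volume := by
    have h1 : AEStronglyMeasurable
        (fun x : ℝ => ((x : ℂ) + Complex.I) * (((x : ℂ) + Complex.I)⁻¹ * h x)) volume :=
      AEStronglyMeasurable.mul (by fun_prop) hh.1
    refine h1.congr (.of_forall fun x => ?_)
    simp only [mul_inv_cancel_left₀ (add_I_ne_zero x)]
  refine hh.of_le_mul (c := C) ((Complex.continuous_conj.comp_aestronglyMeasurable hm).mul
    hl.continuous_invFourier.aestronglyMeasurable) (.of_forall fun x => ?_)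
  have h2 := hC x
  rw [norm_mul] at h2
  have h3 : 0 < ‖(x : ℂ) + Complex.I‖ := norm_pos_iff.2 (add_I_ne_zero x)
  rw [norm_mul, norm_mul, norm_inv, RCLike.norm_conj]
  calc ‖h x‖ * ‖invFourier (fun t => (l t : ℂ)) x‖
      = ‖(x : ℂ) + Complex.I‖ * ‖invFourier (fun t => (l t : ℂ)) x‖ *
          (‖(x : ℂ) + Complex.I‖⁻¹ * ‖h x‖) := by field_simp
    _ ≤ _ := mul_le_mul_of_nonneg_right h2 (by positivity)

/-- Since `conj H · ľ` lies in `L²`, the adjoint on `l` is the compression of this function to the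
interval. The form therefore extends from test functions to every `κ` in `L²`. -/
theorem HasSymbolForm.inner_adjoint
    (hHL : ∀ i j, MemLp (fun x : ℝ => ((x : ℂ) + Complex.I)⁻¹ * H x i j) 2 volume)
    {W : L2Intervals a b →L[ℂ] L2Intervals a b} (hW : HasSymbolForm a b H W) {i : Fin 2}
    {l : ℝ → ℝ} (hl : IsTest ((![a, b] : Fin 2 → ℝ) i) l) (j : Fin 2)
    (κ : Lp ℂ 2 (volIoo ((![a, b] : Fin 2 → ℝ) j))) :
    inner ℂ (W.adjoint (PiLp.single 2 i hl.toL2) j) κ =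
      inner ℂ ((hl.memLp_conj_mul_invFourier (hHL i j)).toLp _)
        (fourierEquiv.symm (extendZero ((![a, b] : Fin 2 → ℝ) j) κ)) := by
  set M : L2R := (hl.memLp_conj_mul_invFourier (hHL i j)).toLp _ with hM
  let B : Lp ℂ 2 (volIoo ((![a, b] : Fin 2 → ℝ) j)) →L[ℂ] L2R :=
    (fourierEquiv.symm.toLinearIsometry.comp
      (extendZero ((![a, b] : Fin 2 → ℝ) j))).toContinuousLinearMap
  have h1 : W.adjoint (PiLp.single 2 i hl.toL2) j = B.adjoint M := by
    refine eq_of_inner_toL2 fun k hk => ?_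
    rw [← inner_conj_symm, adjoint_single_apply hW hl j hk,
      ContinuousLinearMap.adjoint_inner_right, ← inner_conj_symm]
    congr 1
    rw [L2.inner_def]
    refine integral_congr_ae ?_
    filter_upwards [hk.coeFn_fourierEquiv_symm,
      (hl.memLp_conj_mul_invFourier (hHL i j)).coeFn_toLp] with y h2 h3
    change _ = inner ℂ (M y) (fourierEquiv.symm (extendZero _ hk.toL2) y)
    rw [h2, hM, h3, RCLike.inner_apply, map_mul, Complex.conj_conj]
    ring
  rw [h1, ContinuousLinearMap.adjoint_inner_left]
  rfl

theorem HasSymbolForm.inner_intervalsToCircle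
    (hHL : ∀ i j, MemLp (fun x : ℝ => ((x : ℂ) + Complex.I)⁻¹ * H x i j) 2 volume)
    {W : L2Intervals a b →L[ℂ] L2Intervals a b} (hW : HasSymbolForm a b H W) {i : Fin 2}
    {l : ℝ → ℝ} (hl : IsTest ((![a, b] : Fin 2 → ℝ) i) l) {k : L2Intervals a b} {u : L2T2}
    (hu : (u i : T → ℂ) =ᵐ[AddCircle.haarAddCircle]
      fun z => ∑ j, H (cayleyBdry z) i j * (intervalsToCircle a b k j : T → ℂ) z) :
    inner ℂ (intervalsToCircle a b (PiLp.single 2 i hl.toL2)) u = inner ℂ hl.toL2 (W k i) := by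
  rw [inner_intervalsToCircle_single, inner_single_map]
  simp only [hW.inner_adjoint hHL hl]
  simp only [L2.inner_def]
  rw [← integral_finsetSum _ fun j _ => L2.integrable_inner _ _]
  refine integral_congr_ae ?_
  filter_upwards [halfPlaneEquiv_mul_ae_eq hu,
    ae_all_iff.2 fun j => (hl.memLp_conj_mul_invFourier (hHL i j)).coeFn_toLp] with y h1 h2
  rw [h1, Finset.mul_sum]
  refine Finset.sum_congr rfl fun j _ => ?_
  rw [h2, halfPlaneEquiv_intervalsToCircle, RCLike.inner_apply, map_mul, Complex.conj_conj]
  ring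

theorem HasSymbolForm.isMTTO
    (hHL : ∀ i j, MemLp (fun x : ℝ => ((x : ℂ) + Complex.I)⁻¹ * H x i j) 2 volume)
    {W : L2Intervals a b →L[ℂ] L2Intervals a b} (hW : HasSymbolForm a b H W) :
    IsMTTO (diagInnerDisc a b) (fun z => H (cayleyBdry z)) (conjIntervals W) := by
  have hΦ := fun i j => memLp_comp_cayleyBdry (hHL i j)
  refine ⟨hΦ, fun f hf => ?_⟩
  obtain ⟨k, rfl⟩ := (modelEquiv a b).symm.surjective f
  rw [coe_modelEquiv_symm] at hf ⊢
  have hu : ∀ i, MemLp (fun z => ∑ j, H (cayleyBdry z) i j *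
      (intervalsToCircle a b k j : T → ℂ) z) 2 (AddCircle.haarAddCircle : Measure T) :=
    fun i => memLp_finsetSum _ fun j _ => (hf j).mul (hΦ i j)
  refine ⟨WithLp.toLp 2 fun i => (hu i).toLp _, fun i => (hu i).coeFn_toLp, ?_⟩
  set u : L2T2 := WithLp.toLp 2 fun i => (hu i).toLp _ with hudef
  -- For the isometry `J = intervalsToCircle a b`, the product `J J*` is the orthogonal projection
  -- onto its range, the model space. So `J* u = W k` says that `J (W k)` is the projection of `u`.
  have h1 : (intervalsToCircle a b).toContinuousLinearMap.adjoint u = W k := by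
    ext1 i
    refine eq_of_inner_toL2 fun l hl => ?_
    rw [← inner_single_left, ContinuousLinearMap.adjoint_inner_right]
    exact hW.inner_intervalsToCircle hHL hl (hu i).coeFn_toLp
  rw [conjIntervals_apply, LinearIsometryEquiv.apply_symm_apply, coe_modelEquiv_symm,
    Submodule.mem_orthogonal]
  intro g hg
  obtain ⟨k', hk'⟩ := (modelEquiv a b).symm.surjective ⟨g, hg⟩
  have h2 : g = intervalsToCircle a b k' := (congrArg Subtype.val hk').symm
  have h3 := ContinuousLinearMap.adjoint_inner_right
    (intervalsToCircle a b).toContinuousLinearMap k' u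
  rw [h1] at h3
  rw [h2, inner_sub_right, LinearIsometry.inner_map_map, h3, sub_eq_zero]
  rfl

end Main

end

end WienerHopf

/-! ### The main theorem -/

open WienerHopf in
theorem mainTheorem10 (a b : ℝ) (ha : 0 < a) (hb : 0 < b)
    (G H : ℝ → Matrix (Fin 2) (Fin 2) ℂ)
    (hGH : ∀ i j, IsSymbolTransform (fun x => H x i j) (fun t => G t i j))
    (hH : ∀ k : Fin 2 → ℝ → ℂ,
      (∀ j, MemLp (k j) ⊤ (volIoo ((![a, b] : Fin 2 → ℝ) j))) →
      ∀ i, MemLp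
        (fun x => ∑ j, H x i j * invFourierInterval ((![a, b] : Fin 2 → ℝ) j) (k j) x)
        2 (volume : Measure ℝ)) :
    ((∃ W, IsWienerHopf a b G W) ↔
      ∃ A, IsMTTO (diagInnerDisc a b) (fun z => H (cayleyBdry z)) A) ∧
    ∃ U : modelSpace (diagInnerDisc a b) ≃ₗᵢ[ℂ] L2Intervals a b,
      (∀ (f : modelSpace (diagInnerDisc a b)) (i : Fin 2),
        ∃ g : Lp ℂ 2 (volume : Measure ℝ),
          (g : ℝ → ℂ) =ᵐ[volume] halfPlane ((f : L2T2) i : T → ℂ) ∧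
          (U f i : ℝ → ℂ) =ᵐ[volIoo ((![a, b] : Fin 2 → ℝ) i)] unitaryFourier g ∧
          ∀ᵐ t, t ∉ Set.Ioo 0 ((![a, b] : Fin 2 → ℝ) i) → unitaryFourier g t = 0) ∧
      ∀ W A, IsWienerHopf a b G W →
        IsMTTO (diagInnerDisc a b) (fun z => H (cayleyBdry z)) A →
        ∀ f, W (U f) = U (A f) := by
  have hHL := memLp_inv_add_I_mul_symbol ha hb hH
  refine ⟨⟨?_, ?_⟩, modelEquiv a b, modelEquiv_spec a b, ?_⟩
  · rintro ⟨W, hW⟩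
    exact ⟨conjIntervals W, (hW.hasSymbolForm hGH).isMTTO hHL⟩
  · rintro ⟨A, hA⟩
    exact ⟨conjModel A, hA.hasSymbolForm.isWienerHopf hGH⟩
  · intro W A hW hA f
    rw [(hW.hasSymbolForm hGH).unique hA.hasSymbolForm, conjModel_apply,
      LinearIsometryEquiv.symm_apply_apply]
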